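/- Let $N\ge 3$, $0<\mu\le N$, $T>0$, $\alpha>0$. Consider $N$ agents on the line with positions $p_i$, velocities $v_i$ and desired relative positions $p^\star_{ij}=p^\star_i-p^\star_j$ ($p^\star\in\mathbb R^N$; $p^\star=0$ for consensus), and put $\tilde p=p-p^\star$, $\mathbf x=\mathrm{col}(\tilde p,v)$. The agents communicate over a switching network $\mathcal G_{\sigma(t)}$, $t\ge 0$: finitely many undirected graphs on $N$ nodes with Laplacians $\mathsf L_\sigma$, and a piecewise constant, right-continuous switching signal $\sigma$ with finitely many switches in every bounded time interval. A set $\mathcal A$ of malicious agents injects an input $u_{\mathcal A}(t)\in\mathbb R^{|\mathcal A|}$, and the closed loop with gains $\alpha,\gamma>0$ is $$\dot{\mathbf x}=\begin{bmatrix}0&I\\-\alpha\mathsf L_{\sigma(t)}&-\gamma I\end{bmatrix}\mathbf x+\begin{bmatrix}0\\ I_{\mathcal A}\end{bmatrix}u_{\mathcal A},$$ where the columns of $I_{\mathcal A}$ are the canonical vectors of the agents in $\mathcal A$. Let $Q\in\mathbb R^{(N-1)\times N}$ satisfy $Q\mathbf 1=0$, $QQ^\top=I$, $Q^\top Q=I-\frac1N\mathbf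 1\mathbf 1^\top$, and let the output be $\mathcal Y=\mathrm{col}(Q\tilde p,v)$. Norms are Euclidean, and matrix norms are the induced ones. For a signal $f$ that starts at time $t_0$, $\|(f)_{T_d}\|_{\mathcal L_p}$ is the $\mathcal L_p$ norm of $f$ on $[t_0,T_d]$; $f\in\mathcal L_{pe}$ means that this is finite for every $T_d$. The network is called $(\mu,T)$-PE connected if $\frac1T\int_t^{t+T}Q\mathsf L_{\sigma(\tau)}Q^\top d\tau\ge\mu I_{N-1}$ for all $t\ge0$. A denial-of-service (DoS) attack is a sequence of intervals $[t_k,t_k+T^{\rm a}_k)$ on which $\lambda_2(\mathsf L_{\sigma(t)})=0$, where $\lambda_2$ is the second-smallest eigenvalue. For $\gamma,\beta,\lambda_{\mathbf x}>0$ put $$\eta=-\frac1{2T}\ln\Bigl(1-\frac{(\alpha/\gamma)\mu T}{1+(\alpha/\gamma)^2N^2T^2}\Bigr),\qquad \lambda_\chi=\eta e^{-2\eta T},\qquad C=\begin{bmatrix}\frac1\gamma I_{N-1}&-\frac1\gamma Q\\0&I_N\end{bmatrix},$$ $$\kappa_{\mathbf x}=\|C\|\sqrt{\frac{\max\{\lambda_\chi^{-1},\beta\}}{\min\{\frac{\gamma}{\alpha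 N},\beta\}}}\;\|C^{-1}\|,\qquad \kappa_{\mathbf u}=\|C\|\,\frac{\max\{\lambda_\chi^{-1},\beta\}}{\lambda_{\mathbf x}\min\{\frac{\gamma}{2\alpha N},\frac\beta2\}}.$$ There is $\gamma_0>0$, depending only on $N,\mu,T,\alpha$, such that for every $\gamma\ge\gamma_0$ one has $\lambda_\chi>0$, and the following holds for every $\beta>0$, every $\lambda_{\mathbf x}\in(0,\lambda_\chi)$, every such $Q$, every $(\mu,T)$-PE connected network, every DoS attack whose intervals have total length less than $T$ in each time window $[t,t+T)$, $t\ge 0$, and every $t_0\ge0$. (a) For every $\mathcal A$, every $p\in[1,\infty]$, every initial state $\mathbf x(t_0)$ and all inputs $u_{\mathcal A}\in\mathcal L_{pe}$ that are bounded on each $[t_0,T_d]$, the closed loop with output $\mathcal Y$ is finite-gain $\mathcal L_p$ stable with gain $\kappa_{\mathbf u}$ and a finite bias depending on the initial state; explicitly, for all $T_d\ge t_0$ and all $t\ge t_0$, $$\|(\mathcal Y)_{T_d}\|_{\mathcal L_p}\le\bigl\|\bigl(\kappa_{\mathbf x}e^{-\lambda_{\mathbf x}(\cdot-t_0)}\|\mathbf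 x(t_0)\|\bigr)_{T_d}\bigr\|_{\mathcal L_p}+\kappa_{\mathbf u}\|(u_{\mathcal A})_{T_d}\|_{\mathcal L_p},$$ $$\|\mathcal Y(t)\|\le\kappa_{\mathbf x}e^{-\lambda_{\mathbf x}(t-t_0)}\|\mathbf x(t_0)\|+\kappa_{\mathbf u}\|(u_{\mathcal A})_{t}\|_{\mathcal L_p}.$$ (b) If $u_{\mathcal A}=0$, then the trajectories converge uniformly exponentially to the consensus/formation equilibrium: for all agents $i,j$ and all $t\ge t_0$, $$|p_i(t)-p_j(t)-p^\star_{ij}|\le\sqrt2\,\kappa_{\mathbf x}e^{-\lambda_{\mathbf x}(t-t_0)}\|\mathbf x(t_0)\|,\qquad |v_i(t)|\le\kappa_{\mathbf x}e^{-\lambda_{\mathbf x}(t-t_0)}\|\mathbf x(t_0)\|,$$ and in particular $p_i(t)-p_j(t)\to p^\star_{ij}$ and $v_i(t)\to0$ as $t\to\infty$. -/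

import Mathlib

open MeasureTheory Set Filter Topology Matrix

noncomputable section

namespace PEConsensus

/-! ### Communication networks -/

open Classical in
/-- The Laplacian matrix (degree matrix minus adjacency matrix) of an undirected graph. -/
def lap {N : ℕ} (G : SimpleGraph (Fin N)) : Matrix (Fin N) (Fin N) ℝ := G.lapMatrix ℝ

/-- Algebraic connectivity: the second entry of the list of the eigenvalues of the Laplacian,
with multiplicity, in ascending order (the default value is irrelevant for `2 ≤ N`). -/
def algConn {N : ℕ} (G : SimpleGraph (Fin N)) : ℝ :=
  ((lap G).charpoly.roots.sort (· ≤ ·)).getD 1 0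

/-- A switching network on `N` agents: finitely many modes, an undirected graph for each mode, and a
switching signal (only its values at times `t ≥ 0` matter) which is piecewise constant,
right-continuous and switches finitely often on bounded time intervals. -/
structure SwitchingNetwork (N : ℕ) where
  /-- number of modes -/
  modes : ℕ
  /-- the graph of each mode -/
  graph : Fin modes → SimpleGraph (Fin N)
  /-- the switching signal -/
  signal : ℝ → Fin modes
  /-- on `[0, b]` there is a finite set `S` of switching times, and the signal takes the same value
  at `s ≤ t` when no switching time lies in `(s, t]` -/
  finite_switching : ∀ b : ℝ, ∃ S : Finset ℝ, ∀ s t : ℝ, 0 ≤ s → s ≤ t → t ≤ b →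
    (∀ r ∈ S, r ∉ Ioc s t) → signal s = signal t

/-- The graph that is active at time `t`. -/
def SwitchingNetwork.graphAt {N : ℕ} (net : SwitchingNetwork N) (t : ℝ) : SimpleGraph (Fin N) :=
  net.graph (net.signal t)

/-- `Q 𝟏 = 0`, `Q Qᵀ = I`, `Qᵀ Q = I - (1/N) 𝟏 𝟏ᵀ`. -/
structure IsDisagreementMatrix {N : ℕ} (Q : Matrix (Fin (N - 1)) (Fin N) ℝ) : Prop where
  mulVec_one : Q *ᵥ (fun _ => (1 : ℝ)) = 0
  mul_transpose : Q * Qᵀ = 1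
  transpose_mul : Qᵀ * Q = 1 - (N : ℝ)⁻¹ • Matrix.of (fun _ _ => (1 : ℝ))

/-- `(1/T) ∫_t^{t+T} Q L_{σ(τ)} Qᵀ dτ` (entrywise integral). -/
def avgLap {N : ℕ} (net : SwitchingNetwork N) (Q : Matrix (Fin (N - 1)) (Fin N) ℝ) (T t : ℝ) :
    Matrix (Fin (N - 1)) (Fin (N - 1)) ℝ :=
  Matrix.of fun i j => T⁻¹ * ∫ τ in t..(t + T), (Q * lap (net.graphAt τ) * Qᵀ) i j

/-- `(μ, T)`-PE connectivity: the average above is `≥ μ I` in the Loewner order, for all `t ≥ 0`. -/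
def IsPEConnected {N : ℕ} (net : SwitchingNetwork N) (Q : Matrix (Fin (N - 1)) (Fin N) ℝ)
    (μ T : ℝ) : Prop :=
  ∀ t : ℝ, 0 ≤ t →
    (avgLap net Q T t - μ • (1 : Matrix (Fin (N - 1)) (Fin (N - 1)) ℝ)).PosSemidef

/-- A (finite or infinite) sequence of DoS intervals `[t_k, t_k + T_k)`, on which the
network is disconnected, i.e. has algebraic connectivity zero. -/
structure DoSAttack {N : ℕ} (net : SwitchingNetwork N) where
  /-- the indices of the attacks -/
  idx : Set ℕ
  /-- the starting times `t_k` -/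
  start : ℕ → ℝ
  /-- the durations `T_k` -/
  dur : ℕ → ℝ
  start_nonneg : ∀ k ∈ idx, 0 ≤ start k
  dur_pos : ∀ k ∈ idx, 0 < dur k
  disconnected : ∀ k ∈ idx, ∀ t ∈ Ico (start k) (start k + dur k), algConn (net.graphAt t) = 0

/-- In every time window `[t, t + T)` the DoS intervals have total length less than `T`. -/
def DoSAttack.TotalLessThan {N : ℕ} {net : SwitchingNetwork N} (D : DoSAttack net) (T : ℝ) : Prop :=
  ∀ t : ℝ, 0 ≤ t →
    ∑' k : D.idx, volume (Ico (D.start k) (D.start k + D.dur k) ∩ Ico t (t + T)) < ENNReal.ofReal T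

/-! ### The closed loop -/

/-- Action of a matrix on Euclidean vectors. -/
def act {m n : Type*} [Fintype n] (M : Matrix m n ℝ) (x : EuclideanSpace ℝ n) :
    EuclideanSpace ℝ m :=
  WithLp.toLp 2 (M *ᵥ WithLp.ofLp x)

/-- The operator norm of a square matrix induced by the Euclidean norm. -/
def opNorm {n : Type*} [Fintype n] [DecidableEq n] (M : Matrix n n ℝ) : ℝ :=
  ‖Matrix.toEuclideanCLM (n := n) (𝕜 := ℝ) M‖

/-- `col(a, b)`. -/
def stack {m n : Type*} (a : EuclideanSpace ℝ m) (b : EuclideanSpace ℝ n) :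
    EuclideanSpace ℝ (m ⊕ n) :=
  WithLp.toLp 2 (Sum.elim (WithLp.ofLp a) (WithLp.ofLp b))

/-- `A_σ = [0, I; -α L_σ, -γ I]`. -/
def sysMatrix {N : ℕ} (G : SimpleGraph (Fin N)) (α γ : ℝ) :
    Matrix (Fin N ⊕ Fin N) (Fin N ⊕ Fin N) ℝ :=
  Matrix.fromBlocks 0 1 (-(α • lap G)) (-(γ • (1 : Matrix (Fin N) (Fin N) ℝ)))

/-- `I_𝒜`: its columns are the canonical vectors of the malicious agents. -/
def attackDir {N : ℕ} (adv : Finset (Fin N)) : Matrix (Fin N) adv ℝ :=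
  Matrix.of fun i j => if i = (j : Fin N) then 1 else 0

/-- `B_𝒜 = [0; I_𝒜]`. -/
def inputMatrix {N : ℕ} (adv : Finset (Fin N)) : Matrix (Fin N ⊕ Fin N) adv ℝ :=
  Matrix.fromRows 0 (attackDir adv)

/-- `x` solves `ẋ = A_σ x + B_𝒜 u` on `[t₀, ∞)`, in the sense of Carathéodory. -/
structure IsTrajectory {N : ℕ} (net : SwitchingNetwork N) (α γ : ℝ) (adv : Finset (Fin N))
    (u : ℝ → EuclideanSpace ℝ adv) (t₀ : ℝ) (x : ℝ → EuclideanSpace ℝ (Fin N ⊕ Fin N)) : Prop where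
  continuousOn : ContinuousOn x (Ici t₀)
  integrable : ∀ t, t₀ ≤ t → IntervalIntegrable
    (fun s => act (sysMatrix (net.graphAt s) α γ) (x s) + act (inputMatrix adv) (u s)) volume t₀ t
  integral_eq : ∀ t, t₀ ≤ t → x t = x t₀ +
    ∫ s in t₀..t, (act (sysMatrix (net.graphAt s) α γ) (x s) + act (inputMatrix adv) (u s))

/-- The output `𝒴 = col(Q p̃, v)`, that is `[Q, 0; 0, I] x`. -/
def output {N : ℕ} (Q : Matrix (Fin (N - 1)) (Fin N) ℝ) (x : EuclideanSpace ℝ (Fin N ⊕ Fin N)) :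
    EuclideanSpace ℝ (Fin (N - 1) ⊕ Fin N) :=
  act (Matrix.fromBlocks Q 0 0 (1 : Matrix (Fin N) (Fin N) ℝ)) x

/-! ### Signals -/

/-- The `L_p` norm of the truncation to `[t₀, T_d]` of a signal that starts at time `t₀`. -/
def truncNorm {E : Type*} [NormedAddCommGroup E] (p : ENNReal) (t₀ Td : ℝ) (f : ℝ → E) : ENNReal :=
  eLpNorm f p (volume.restrict (Icc t₀ Td))

/-- The signal is in the extended space `L_{pe}` and it is bounded on each `[t₀, T_d]`. -/
structure IsAdmissibleInput {E : Type*} [NormedAddCommGroup E] (p : ENNReal) (t₀ : ℝ)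
    (u : ℝ → E) : Prop where
  memLpe : ∀ Td, t₀ ≤ Td → MemLp u p (volume.restrict (Icc t₀ Td))
  bounded : ∀ Td, t₀ ≤ Td → BddAbove ((fun t => ‖u t‖) '' Icc t₀ Td)

/-- A set of input-output pairs is finite-gain `L_p` stable with gain `κ` (and some finite bias). -/
def IsFiniteGainLpStable {E F : Type*} [NormedAddCommGroup E] [NormedAddCommGroup F] (p : ENNReal)
    (t₀ : ℝ) (pairs : Set ((ℝ → E) × (ℝ → F))) (κ : ℝ) : Prop :=
  0 ≤ κ ∧ ∃ b : ℝ, 0 ≤ b ∧ ∀ w ∈ pairs, ∀ Td, t₀ ≤ Td →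
    truncNorm p t₀ Td w.2 ≤ ENNReal.ofReal κ * truncNorm p t₀ Td w.1 + ENNReal.ofReal b

/-- The input-output pairs `(u, 𝒴)` of the closed loop with initial state `x₀` at time `t₀`. -/
def ioPairs {N : ℕ} (net : SwitchingNetwork N) (Q : Matrix (Fin (N - 1)) (Fin N) ℝ) (α γ : ℝ)
    (adv : Finset (Fin N)) (p : ENNReal) (t₀ : ℝ) (x₀ : EuclideanSpace ℝ (Fin N ⊕ Fin N)) :
    Set ((ℝ → EuclideanSpace ℝ adv) × (ℝ → EuclideanSpace ℝ (Fin (N - 1) ⊕ Fin N))) :=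
  {w | IsAdmissibleInput p t₀ w.1 ∧
    ∃ x, IsTrajectory net α γ adv w.1 t₀ x ∧ x t₀ = x₀ ∧ w.2 = fun t => output Q (x t)}

/-! ### The constants -/

/-- `η = -(1/(2T)) ln(1 - (α/γ) μ T / (1 + (α/γ)² N² T²))`. -/
def eta (N : ℕ) (μ T α γ : ℝ) : ℝ :=
  -(1 / (2 * T)) * Real.log (1 - (α / γ) * μ * T / (1 + (α / γ) ^ 2 * (N : ℝ) ^ 2 * T ^ 2))

/-- `λ_χ = η e^{-2 η T}`. -/
def lamChi (N : ℕ) (μ T α γ : ℝ) : ℝ :=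
  eta N μ T α γ * Real.exp (-2 * eta N μ T α γ * T)

/-- `C = [(1/γ) I, -(1/γ) Q; 0, I]`. -/
def Cmat {N : ℕ} (Q : Matrix (Fin (N - 1)) (Fin N) ℝ) (γ : ℝ) :
    Matrix (Fin (N - 1) ⊕ Fin N) (Fin (N - 1) ⊕ Fin N) ℝ :=
  Matrix.fromBlocks ((1 / γ) • (1 : Matrix (Fin (N - 1)) (Fin (N - 1)) ℝ)) (-((1 / γ) • Q)) 0 1

/-- `κ_x = ‖C‖ √(max{λ_χ⁻¹, β} / min{γ/(αN), β}) ‖C⁻¹‖`. -/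
def kappaX {N : ℕ} (Q : Matrix (Fin (N - 1)) (Fin N) ℝ) (μ T α γ β : ℝ) : ℝ :=
  opNorm (Cmat Q γ) *
    Real.sqrt (max (lamChi N μ T α γ)⁻¹ β / min (γ / (α * N)) β) * opNorm (Cmat Q γ)⁻¹

/-- `κ_u = ‖C‖ max{λ_χ⁻¹, β} / (λ_x min{γ/(2αN), β/2})`. -/
def kappaU {N : ℕ} (Q : Matrix (Fin (N - 1)) (Fin N) ℝ) (μ T α γ β lamX : ℝ) : ℝ :=
  opNorm (Cmat Q γ) *
    (max (lamChi N μ T α γ)⁻¹ β / (lamX * min (γ / (2 * α * N)) (β / 2)))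

end PEConsensus

end

/-!
In the coordinates `χ = γ Q p̃ + Q v` and `v`, that is `col(χ, v) = C⁻¹ 𝒴`, the closed loop splits
into a slow and a fast part: with `ε = α / γ` and `M = Q L Qᵀ`,
`χ' = -ε M χ + ε Q L v + Q I_𝒜 u` and `v' = -γ v - ε L Qᵀ χ + ε L v + I_𝒜 u`.
At no instant need `M` be positive definite, but its average over a window of length `T` is at least
`μ`. A near-identity change of the norm of `χ` turns `M` into that average: for
`R(t) = F(t) - (1/T) ∫_t^{t+T} F` with `F` a primitive of `M`, one has `R' = M - avg M` and
`‖R‖ = O(T)`, so along solutions the function `W = ‖χ‖² + 2 ε ⟪χ, R χ⟫ + ‖v‖²` satisfies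
`W' ≤ -(2 ε μ - O(ε²)) ‖χ‖² + O(ε) ‖χ‖ ‖v‖ - 2 (γ - O(ε)) ‖v‖² + O(√W ‖u‖)`.
For large `γ` this gives `W' ≤ -ε μ W + O(√W ‖u‖)` (`lyap_deriv_le`), hence
`‖C⁻¹ 𝒴(t)‖ ≤ √2 e^{-λ (t - t₀)} ‖C⁻¹ 𝒴(t₀)‖ + 4 ∫ e^{-λ (t - s)} ‖u(s)‖ ds` for
`0 ≤ λ ≤ ε μ / 2` (`norm_le_of_persistent_excitation`).

This is stronger than needed. The rate suffices because `λ_χ ≤ ε μ / 2` (`lamChi_bounds`), by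
`-(1 - y) log (1 - y) ≤ y`. The constants suffice because the ratio
`max{λ_χ⁻¹, β} / min{γ/(αN), β}` is at least `2 N / μ ≥ 2` for every `β` (`two_le_ratio`).

The inputs are merely measurable and locally bounded, so trajectories are Lipschitz on compact
intervals and differentiable almost everywhere; the differential inequality for `W` is integrated
through the fundamental theorem of calculus for absolutely continuous functions
(`sqrt_le_of_ae_deriv_le`). The `L_p` bounds follow from Young's inequality for the kernel
`λ e^{-λ r}`, `r ≥ 0`, a probability density (`eLpNorm_expConv_le`, `ofReal_expConv_le_eLpNorm`).
-/

noncomputable section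

namespace PEConsensus

/-! ### Differential inequalities along Lipschitz curves -/

theorem lipschitzOnWith_sqrt_add {W : ℝ → ℝ} {s : Set ℝ} {K : NNReal}
    (hW : LipschitzOnWith K W s) (h0 : ∀ t ∈ s, 0 ≤ W t) {δ : ℝ} (hδ : 0 < δ) :
    ∃ K' : NNReal, LipschitzOnWith K' (fun t => √(W t + δ)) s := by
  refine ⟨K * (Real.toNNReal (1 / √δ)), LipschitzOnWith.of_dist_le_mul fun x hx y hy => ?_⟩
  have h1 : √δ ≤ √(W x + δ) := Real.sqrt_le_sqrt (by linarith [h0 x hx])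
  have h2 : 0 ≤ √(W y + δ) := Real.sqrt_nonneg _
  have h3 : 0 < √δ := Real.sqrt_pos.2 hδ
  have h4 := hW.dist_le_mul x hx y hy
  have e1 := Real.sq_sqrt (show 0 ≤ W x + δ by linarith [h0 x hx])
  have e2 := Real.sq_sqrt (show 0 ≤ W y + δ by linarith [h0 y hy])
  rw [Real.dist_eq] at h4 ⊢
  have h5 : |√(W x + δ) - √(W y + δ)| * √δ ≤ |W x - W y| := by
    have : W x - W y = (√(W x + δ) - √(W y + δ)) * (√(W x + δ) + √(W y + δ)) := by
      linear_combination e2 - e1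
    rw [this, abs_mul]
    gcongr
    exact le_abs.2 (Or.inl (by linarith))
  have h6 : |√(W x + δ) - √(W y + δ)| ≤ |W x - W y| / √δ := (le_div_iff₀ h3).2 h5
  refine h6.trans ?_
  rw [NNReal.coe_mul, Real.coe_toNNReal _ (by positivity)]
  calc |W x - W y| / √δ ≤ (K * dist x y) / √δ := by gcongr
    _ = _ := by rw [Real.dist_eq]; ring

/-- In terms of `√W` the hypothesis reads `(√W)' ≤ -lam √W + g`. The square root is regularised by
`δ > 0` to stay differentiable where `W` vanishes. -/
theorem sqrt_add_le_of_ae_deriv_le {W g : ℝ → ℝ} {a b lam : ℝ} {K : NNReal} (hab : a ≤ b)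
    (hlam : 0 ≤ lam) (hW : LipschitzOnWith K W (Icc a b)) (h0 : ∀ t ∈ Icc a b, 0 ≤ W t)
    (hg : IntervalIntegrable g volume a b) (hg0 : ∀ t, 0 ≤ g t)
    (hd : ∀ᵐ t, t ∈ Ioo a b → ∃ W', HasDerivAt W W' t ∧ W' ≤ -2 * lam * W t + 2 * g t * √(W t))
    {δ : ℝ} (hδ : 0 < δ) :
    √(W b + δ) ≤ Real.exp (-lam * (b - a)) * √(W a + δ) +
      ∫ s in a..b, Real.exp (-lam * (b - s)) * (g s + lam * √δ) := by
  obtain ⟨K', hK'⟩ := lipschitzOnWith_sqrt_add hW h0 hδ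
  have hac : AbsolutelyContinuousOnInterval
      (fun t => Real.exp (lam * t) * √(W t + δ)) a b := by
    refine AbsolutelyContinuousOnInterval.fun_mul ?_ ?_
    · exact ContDiffOn.absolutelyContinuousOnInterval (by fun_prop)
    · rw [← uIcc_of_le hab] at hK'
      exact hK'.absolutelyContinuousOnInterval
  have hint := hac.integral_deriv_eq_sub
  have hrhs : IntervalIntegrable (fun s => Real.exp (lam * s) * (g s + lam * √δ)) volume a b := by
    refine IntervalIntegrable.continuousOn_mul (hg.add intervalIntegrable_const) ?_
    fun_prop
  have hle : ∫ s in a..b, deriv (fun t => Real.exp (lam * t) * √(W t + δ)) s ≤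
      ∫ s in a..b, Real.exp (lam * s) * (g s + lam * √δ) := by
    have hne : ∀ c : ℝ, ∀ᵐ t : ℝ, t ≠ c := fun c => by simp [ae_iff, measure_singleton]
    refine intervalIntegral.integral_mono_ae_restrict hab hac.intervalIntegrable_deriv hrhs ?_
    rw [EventuallyLE, ae_restrict_iff' measurableSet_Icc]
    filter_upwards [hd, hne a, hne b] with t ht hta htb htI
    obtain ⟨W', hW', hWle⟩ := ht ⟨lt_of_le_of_ne htI.1 hta.symm, lt_of_le_of_ne htI.2 htb⟩
    have hWt := h0 t htI
    have hpos : 0 < W t + δ := by linarith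
    have hder := ((hasDerivAt_id' t).const_mul lam).exp.mul ((hW'.add_const δ).sqrt hpos.ne')
    have hy := Real.sqrt_pos.2 hpos
    have hy2 := Real.sq_sqrt hpos.le
    have hδy : √δ ≤ √(W t + δ) := Real.sqrt_le_sqrt (by linarith)
    have hWy : √(W t) ≤ √(W t + δ) := Real.sqrt_le_sqrt (by linarith)
    have hδ2 := Real.mul_self_sqrt hδ.le
    have hquot : W' / (2 * √(W t + δ)) ≤ -lam * √(W t + δ) + (g t + lam * √δ) := by
      rw [div_le_iff₀ (by positivity)]
      have k1 := mul_le_mul_of_nonneg_left hWy (hg0 t)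
      have k2 := mul_le_mul_of_nonneg_left hδy (mul_nonneg hlam (Real.sqrt_nonneg δ))
      linear_combination hWle + 2 * k1 + 2 * k2 + 2 * lam * hy2 - 2 * lam * hδ2
    refine hder.deriv.trans_le ?_
    have k3 := mul_le_mul_of_nonneg_left hquot (Real.exp_pos (lam * t)).le
    linear_combination k3
  rw [hint] at hle
  have hE : ∀ s, Real.exp (-lam * (b - s)) = Real.exp (-lam * b) * Real.exp (lam * s) := by
    intro s; rw [← Real.exp_add]; congr 1; ring
  have h1 : Real.exp (-lam * b) * Real.exp (lam * b) = 1 := by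
    rw [← Real.exp_add]; simp
  simp_rw [hE, mul_assoc]
  rw [intervalIntegral.integral_const_mul]
  have h2 := mul_le_mul_of_nonneg_left hle (Real.exp_pos (-lam * b)).le
  linear_combination h2 - √(W b + δ) * h1

/-- The Grönwall-type comparison `(√W)' ≤ -lam √W + g`, for the square root of a Lipschitz function
whose derivative is controlled only almost everywhere. -/
theorem sqrt_le_of_ae_deriv_le {W g : ℝ → ℝ} {a b lam : ℝ} {K : NNReal} (hab : a ≤ b)
    (hlam : 0 ≤ lam) (hW : LipschitzOnWith K W (Icc a b)) (h0 : ∀ t ∈ Icc a b, 0 ≤ W t)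
    (hg : IntervalIntegrable g volume a b) (hg0 : ∀ t, 0 ≤ g t)
    (hd : ∀ᵐ t, t ∈ Ioo a b → ∃ W', HasDerivAt W W' t ∧ W' ≤ -2 * lam * W t + 2 * g t * √(W t)) :
    √(W b) ≤ Real.exp (-lam * (b - a)) * √(W a) +
      ∫ s in a..b, Real.exp (-lam * (b - s)) * g s := by
  have hc : ∀ h : ℝ → ℝ, IntervalIntegrable h volume a b →
      IntervalIntegrable (fun s => Real.exp (-lam * (b - s)) * h s) volume a b := fun h hh =>
    hh.continuousOn_mul (by fun_prop)
  have key : ∀ δ > 0, √(W b + δ) ≤ Real.exp (-lam * (b - a)) * √(W a + δ) +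
      ((∫ s in a..b, Real.exp (-lam * (b - s)) * g s) +
        (∫ s in a..b, Real.exp (-lam * (b - s)) * lam) * √δ) := by
    intro δ hδ
    refine (sqrt_add_le_of_ae_deriv_le hab hlam hW h0 hg hg0 hd hδ).trans_eq ?_
    rw [← intervalIntegral.integral_mul_const, ← intervalIntegral.integral_add (hc g hg)]
    · congr 2; ext s; ring
    · exact (hc (fun _ => lam) intervalIntegrable_const).mul_const _
  have l1 : Tendsto (fun δ => √(W b + δ)) (𝓝[>] 0) (𝓝 (√(W b))) := by
    have : Continuous fun δ => √(W b + δ) := by fun_prop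
    simpa using (this.tendsto 0).mono_left nhdsWithin_le_nhds
  have l2 : Tendsto (fun δ => Real.exp (-lam * (b - a)) * √(W a + δ) +
      ((∫ s in a..b, Real.exp (-lam * (b - s)) * g s) +
        (∫ s in a..b, Real.exp (-lam * (b - s)) * lam) * √δ)) (𝓝[>] 0)
      (𝓝 (Real.exp (-lam * (b - a)) * √(W a) +
      ∫ s in a..b, Real.exp (-lam * (b - s)) * g s)) := by
    have : Continuous fun δ => Real.exp (-lam * (b - a)) * √(W a + δ) +
      ((∫ s in a..b, Real.exp (-lam * (b - s)) * g s) +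
        (∫ s in a..b, Real.exp (-lam * (b - s)) * lam) * √δ) := by fun_prop
    simpa using (this.tendsto 0).mono_left nhdsWithin_le_nhds
  exact le_of_tendsto_of_tendsto l1 l2 (eventually_nhdsWithin_of_forall key)

theorem lipschitzOnWith_of_eq_integral {E : Type*} [NormedAddCommGroup E] [NormedSpace ℝ E]
    {x f : ℝ → E} {a b : ℝ} {C : NNReal} (hC : ∀ t ∈ Icc a b, ‖f t‖ ≤ C)
    (hf : ∀ t ∈ Icc a b, IntervalIntegrable f volume a t)
    (hx : ∀ t ∈ Icc a b, x t = x a + ∫ s in a..t, f s) :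
    LipschitzOnWith C x (Icc a b) := by
  refine LipschitzOnWith.of_dist_le_mul fun s hs t ht => ?_
  rw [dist_eq_norm, hx s hs, hx t ht, add_sub_add_left_eq_sub,
    intervalIntegral.integral_interval_sub_left (hf s hs) (hf t ht), Real.dist_eq]
  refine intervalIntegral.norm_integral_le_of_norm_le_const fun r hr => hC r ?_
  exact uIcc_subset_Icc ht hs (uIoc_subset_uIcc hr)

theorem ae_hasDerivAt_of_eq_integral {E : Type*} [NormedAddCommGroup E] [NormedSpace ℝ E]
    [CompleteSpace E] {x f : ℝ → E} {a b : ℝ}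
    (hf : IntervalIntegrable f volume a b)
    (hx : ∀ t ∈ Icc a b, x t = x a + ∫ s in a..t, f s) :
    ∀ᵐ t, t ∈ Ioo a b → HasDerivAt x (f t) t := by
  filter_upwards [hf.ae_hasDerivAt_integral] with t ht hab
  have hab' : a ≤ b := (hab.1.trans hab.2).le
  have := (ht (by rw [uIcc_of_le hab']; exact Ioo_subset_Icc_self hab) a (by simp)).const_add (x a)
  refine this.congr_of_eventuallyEq ?_
  filter_upwards [Ioo_mem_nhds hab.1 hab.2] with s hs using hx s (Ioo_subset_Icc_self hs)

/-! ### The averaging Lyapunov function -/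

/-- The real-number form of the dissipation estimate: `a = ‖χ‖`, `b = ‖v‖`, and `ω` bounds the
inputs. The left-hand side collects the bounds on the terms of the derivative of the Lyapunov
function. Of the decay `-2 ε μ a²` half is kept, and the other half absorbs the terms of order `ε²`
and, after completing the square, the coupling of `χ` and `v`. -/
theorem dissipation_estimate {a b ω ε γ μ K T : ℝ} (ha : 0 ≤ a) (hb : 0 ≤ b) (hω : 0 ≤ ω)
    (hε : 0 < ε) (hμ : 0 < μ) (hK : 0 < K) (hT : 0 < T)
    (h1 : ε * K * T ≤ 1 / 6) (h2 : 12 * (ε * K * T) * K ≤ μ)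
    (h3 : ε * (2 * K + 19 * (K ^ 2 / μ) + μ) ≤ 2 * γ) :
    -(2 * ε * μ) * a ^ 2 + 2 * ε * K * (a * b) + 2 * (a * ω) +
        4 * (ε * K * T) * (a * (ε * K * a + ε * K * b + ω)) - 2 * γ * b ^ 2 +
        2 * ε * K * (a * b) + 2 * ε * K * b ^ 2 + 2 * (b * ω) ≤
      -(ε * μ) * ((1 + 2 * (ε * K * T)) * a ^ 2 + b ^ 2) + 2 * ((4 / 3 * a + b) * ω) := by
  set ρ := ε * K * T with hρ
  have hρ0 : 0 ≤ ρ := by positivity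
  have e1 : ρ * (a * ω) ≤ 1 / 6 * (a * ω) := by gcongr
  have e2 : ε * (12 * ρ * K) * a ^ 2 ≤ ε * μ * a ^ 2 := by gcongr
  have e3 : ρ * (ε * K * (a * b)) ≤ 1 / 6 * (ε * K * (a * b)) := by gcongr
  have e4 : ρ * (ε * μ * a ^ 2) ≤ 1 / 6 * (ε * μ * a ^ 2) := by gcongr
  have e5 : ε * (2 * K + 19 * (K ^ 2 / μ) + μ) * b ^ 2 ≤ 2 * γ * b ^ 2 := by gcongr
  -- Young's inequality for the coupling; completing the square leaves `75 / 4 < 19` on `b ^ 2`.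
  have e6 : 5 * K * (a * b) ≤ μ / 3 * a ^ 2 + 19 * (K ^ 2 / μ) * b ^ 2 := by
    have : 0 ≤ (μ * a - 15 / 2 * (K * b)) ^ 2 / (3 * μ) + K ^ 2 / μ * b ^ 2 / 4 := by positivity
    have e : (μ * a - 15 / 2 * (K * b)) ^ 2 / (3 * μ) =
        μ / 3 * a ^ 2 - 5 * K * (a * b) + 75 / 4 * (K ^ 2 / μ) * b ^ 2 := by
      field_simp; ring
    linarith
  have e7 := mul_le_mul_of_nonneg_left e6 hε.le
  have e8 : 0 ≤ ε * K * (a * b) := by positivity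
  linear_combination 4 * e1 + e2 / 3 + 4 * e3 + 2 * e4 + e5 + e7 + e8 / 3

theorem weighted_add_le_sqrt {a b W : ℝ} (h : 2 / 3 * (a ^ 2 + b ^ 2) ≤ W) :
    4 / 3 * a + b ≤ 9 / 4 * √W := by
  have hW : 0 ≤ W := le_trans (by positivity) h
  refine (abs_le_of_sq_le_sq' ?_ (by positivity)).2
  rw [mul_pow, Real.sq_sqrt hW]
  linear_combination 25 / 6 * h + 43 / 48 * hW + sq_nonneg (a - 4 / 3 * b)

section Lyapunov

variable {E F : Type*} [NormedAddCommGroup E] [InnerProductSpace ℝ E] [NormedAddCommGroup F]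

/-- The Lyapunov function `‖χ‖² + 2 ε ⟪χ, R χ⟫ + ‖v‖²`. The cross term, with `R` the corrector below,
trades the excitation at one instant for its average over a window. -/
def lyap (ε : ℝ) (R : E →L[ℝ] E) (χ : E) (v : F) : ℝ :=
  ‖χ‖ ^ 2 + 2 * ε * inner ℝ χ (R χ) + ‖v‖ ^ 2

theorem abs_two_mul_inner_le {ε K T : ℝ} (hε : 0 < ε) {R : E →L[ℝ] E} (hR : ‖R‖ ≤ K * T) (χ : E) :
    |2 * ε * inner ℝ χ (R χ)| ≤ 2 * (ε * K * T) * ‖χ‖ ^ 2 := by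
  have h1 := abs_real_inner_le_norm χ (R χ)
  have h2 := R.le_of_opNorm_le hR χ
  rw [abs_mul, abs_of_pos (by positivity : 0 < 2 * ε)]
  calc 2 * ε * |inner ℝ χ (R χ)| ≤ 2 * ε * (‖χ‖ * (K * T * ‖χ‖)) := by
        gcongr; exact h1.trans (by gcongr)
    _ = _ := by ring

theorem lyap_le {ε K T : ℝ} (hε : 0 < ε) {R : E →L[ℝ] E} (hR : ‖R‖ ≤ K * T) (χ : E) (v : F) :
    lyap ε R χ v ≤ (1 + 2 * (ε * K * T)) * ‖χ‖ ^ 2 + ‖v‖ ^ 2 := by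
  have := (abs_le.1 (abs_two_mul_inner_le hε hR χ)).2
  unfold lyap; linarith

theorem le_lyap {ε K T : ℝ} (hε : 0 < ε) {R : E →L[ℝ] E} (hR : ‖R‖ ≤ K * T)
    (h1 : ε * K * T ≤ 1 / 6) (χ : E) (v : F) :
    2 / 3 * (‖χ‖ ^ 2 + ‖v‖ ^ 2) ≤ lyap ε R χ v := by
  have := (abs_le.1 (abs_two_mul_inner_le hε hR χ)).1
  have h2 := mul_le_mul_of_nonneg_right h1 (sq_nonneg ‖χ‖)
  have h3 := sq_nonneg ‖v‖
  unfold lyap; linarith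

variable [InnerProductSpace ℝ F]

/-- The left-hand side is the derivative of `lyap ε R χ v` when `R`, `χ` and `v` have the derivatives
`M - Mavg`, `dχ` and `dv`. The terms `⟪χ, M χ⟫` cancel, and `M` itself need not be coercive: only its
average has to be. -/
theorem lyap_deriv_le {ε γ μ K T ω : ℝ} (hε : 0 < ε) (hμ : 0 < μ) (hK : 0 < K) (hT : 0 < T)
    (h1 : ε * K * T ≤ 1 / 6) (h2 : 12 * (ε * K * T) * K ≤ μ)
    (h3 : ε * (2 * K + 19 * (K ^ 2 / μ) + μ) ≤ 2 * γ)
    {R M Mavg : E →L[ℝ] E} {B : F →L[ℝ] E} {B' : E →L[ℝ] F} {L : F →L[ℝ] F}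
    (hR : ‖R‖ ≤ K * T) (hM : ‖M‖ ≤ K) (hB : ‖B‖ ≤ K) (hB' : ‖B'‖ ≤ K) (hL : ‖L‖ ≤ K)
    {χ dχ q : E} {v dv r : F} (hPE : μ * ‖χ‖ ^ 2 ≤ inner ℝ χ (Mavg χ))
    (hq : ‖q‖ ≤ ω) (hr : ‖r‖ ≤ ω) (hdχ : dχ = -(ε • M χ) + ε • B v + q)
    (hdv : dv = -(γ • v) - ε • B' χ + ε • L v + r) :
    2 * inner ℝ χ dχ + 2 * ε * (inner ℝ χ ((M - Mavg) χ + R dχ) + inner ℝ dχ (R χ)) +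
        2 * inner ℝ v dv ≤
      -(ε * μ) * lyap ε R χ v + 2 * (9 / 4 * ω) * √(lyap ε R χ v) := by
  have hω : 0 ≤ ω := (norm_nonneg q).trans hq
  have hn : ‖dχ‖ ≤ ε * K * ‖χ‖ + ε * K * ‖v‖ + ω := by
    rw [hdχ]
    refine (norm_add₃_le).trans ?_
    rw [norm_neg, norm_smul, norm_smul, Real.norm_of_nonneg hε.le, mul_assoc, mul_assoc]
    gcongr
    · exact M.le_of_opNorm_le hM χ
    · exact B.le_of_opNorm_le hB v
  have i1 : inner ℝ χ dχ = -(ε * inner ℝ χ (M χ)) + ε * inner ℝ χ (B v) + inner ℝ χ q := by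
    rw [hdχ]; simp [inner_add_right, inner_smul_right]
  have i2 : inner ℝ v dv = -(γ * ‖v‖ ^ 2) - ε * inner ℝ v (B' χ) + ε * inner ℝ v (L v) +
      inner ℝ v r := by
    rw [hdv]; simp [inner_add_right, inner_sub_right, inner_smul_right]
  have i3 : inner ℝ χ ((M - Mavg) χ + R dχ) =
      inner ℝ χ (M χ) - inner ℝ χ (Mavg χ) + inner ℝ χ (R dχ) := by
    simp [inner_add_right, inner_sub_right]
  have b1 : inner ℝ χ (B v) ≤ ‖χ‖ * (K * ‖v‖) :=
    (real_inner_le_norm _ _).trans (by gcongr; exact B.le_of_opNorm_le hB v)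
  have b2 : inner ℝ χ q ≤ ‖χ‖ * ω := (real_inner_le_norm _ _).trans (by gcongr)
  have b3 : -inner ℝ v (B' χ) ≤ ‖v‖ * (K * ‖χ‖) :=
    (neg_le_abs _).trans ((abs_real_inner_le_norm _ _).trans
      (by gcongr; exact B'.le_of_opNorm_le hB' χ))
  have b4 : inner ℝ v (L v) ≤ ‖v‖ * (K * ‖v‖) :=
    (real_inner_le_norm _ _).trans (by gcongr; exact L.le_of_opNorm_le hL v)
  have b5 : inner ℝ v r ≤ ‖v‖ * ω := (real_inner_le_norm _ _).trans (by gcongr)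
  have b6 : inner ℝ χ (R dχ) ≤ ‖χ‖ * (K * T * (ε * K * ‖χ‖ + ε * K * ‖v‖ + ω)) :=
    (real_inner_le_norm _ _).trans (by gcongr; exact (R.le_of_opNorm_le hR dχ).trans (by gcongr))
  have b7 : inner ℝ dχ (R χ) ≤ (ε * K * ‖χ‖ + ε * K * ‖v‖ + ω) * (K * T * ‖χ‖) :=
    (real_inner_le_norm _ _).trans (by gcongr; exact R.le_of_opNorm_le hR χ)
  have main := dissipation_estimate (norm_nonneg χ) (norm_nonneg v) hω hε hμ hK hT h1 h2 h3
  have hup := lyap_le hε hR χ v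
  have hlo := le_lyap hε hR h1 χ v
  have hlin : 4 / 3 * ‖χ‖ + ‖v‖ ≤ 9 / 4 * √(lyap ε R χ v) := weighted_add_le_sqrt hlo
  have hlin' := mul_le_mul_of_nonneg_right hlin hω
  have hup' := mul_le_mul_of_nonneg_left hup (mul_pos hε hμ).le
  rw [i1, i2, i3]
  have c1 := mul_le_mul_of_nonneg_left b1 hε.le
  have c3 := mul_le_mul_of_nonneg_left b3 hε.le
  have c4 := mul_le_mul_of_nonneg_left b4 hε.le
  have c6 := mul_le_mul_of_nonneg_left b6 hε.le
  have c7 := mul_le_mul_of_nonneg_left b7 hε.le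
  have c8 := mul_le_mul_of_nonneg_left hPE hε.le
  linear_combination main + 2 * hlin' + hup' + 2 * c1 + 2 * b2 + 2 * c3 + 2 * c4 + 2 * b5 +
    2 * c6 + 2 * c7 + 2 * c8

theorem contDiff_lyap (ε : ℝ) :
    ContDiff ℝ 1 (fun z : (E →L[ℝ] E) × E × F => lyap ε z.1 z.2.1 z.2.2) := by
  have e0 : ContDiff ℝ 1 fun z : (E →L[ℝ] E) × E × F => z.2.1 := contDiff_fst.comp contDiff_snd
  have e1 : ContDiff ℝ 1 fun z : (E →L[ℝ] E) × E × F => ‖z.2.1‖ ^ 2 := e0.norm_sq ℝ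
  have e2 : ContDiff ℝ 1 fun z : (E →L[ℝ] E) × E × F => ‖z.2.2‖ ^ 2 :=
    (contDiff_snd.comp contDiff_snd).norm_sq ℝ
  have e3 : ContDiff ℝ 1 fun z : (E →L[ℝ] E) × E × F => inner ℝ z.2.1 (z.1 z.2.1) :=
    e0.inner ℝ (contDiff_fst.clm_apply e0)
  exact (e1.add (contDiff_const.mul e3)).add e2

theorem lipschitzOnWith_lyap [FiniteDimensional ℝ E] [FiniteDimensional ℝ F] {ε a b : ℝ}
    {R : ℝ → E →L[ℝ] E} {χ : ℝ → E} {v : ℝ → F} {C₁ C₂ C₃ : NNReal}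
    (hR : LipschitzOnWith C₁ R (Icc a b)) (hχ : LipschitzOnWith C₂ χ (Icc a b))
    (hv : LipschitzOnWith C₃ v (Icc a b)) :
    ∃ C : NNReal, LipschitzOnWith C (fun t => lyap ε (R t) (χ t) (v t)) (Icc a b) := by
  have hy := hR.prodMk (hχ.prodMk hv)
  have : ProperSpace ((E →L[ℝ] E) × E × F) := FiniteDimensional.proper_real _
  obtain ⟨r, hr⟩ := (isCompact_Icc.image_of_continuousOn hy.continuousOn).isBounded.subset_closedBall
    0
  have hc : IsCompact (Metric.closedBall (0 : (E →L[ℝ] E) × E × F) r) := isCompact_closedBall _ _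
  obtain ⟨K, hK⟩ := (contDiff_lyap (E := E) (F := F) ε).contDiffOn.exists_lipschitzOnWith one_ne_zero
    (convex_closedBall (0 : (E →L[ℝ] E) × E × F) r) hc
  have hcomp := hK.comp hy (fun t ht => hr (mem_image_of_mem _ ht))
  exact ⟨_, hcomp⟩

/-- Exponential decay and input gain of a slow system `χ' = -ε M χ + …` with persistently exciting
`M`, coupled to a fast system `v' = -γ v + …`. The rate `ε μ / 2` falls short of the averaged rate
`ε μ` because of the margins taken in the dissipation estimate. -/
theorem norm_le_of_persistent_excitation [FiniteDimensional ℝ E] [FiniteDimensional ℝ F]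
    {ε γ μ K T a b lam : ℝ} (hε : 0 < ε) (hμ : 0 < μ) (hK : 0 < K) (hT : 0 < T)
    (h1 : ε * K * T ≤ 1 / 6) (h2 : 12 * (ε * K * T) * K ≤ μ)
    (h3 : ε * (2 * K + 19 * (K ^ 2 / μ) + μ) ≤ 2 * γ) (hab : a ≤ b) (hlam : 0 ≤ lam)
    (hlam' : lam ≤ ε * μ / 2)
    {R M Mavg : ℝ → E →L[ℝ] E} {B : ℝ → F →L[ℝ] E} {B' : ℝ → E →L[ℝ] F} {L : ℝ → F →L[ℝ] F}
    {χ q : ℝ → E} {v r : ℝ → F} {ω : ℝ → ℝ} {C₁ C₂ C₃ : NNReal}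
    (hRl : LipschitzOnWith C₁ R (Icc a b)) (hχl : LipschitzOnWith C₂ χ (Icc a b))
    (hvl : LipschitzOnWith C₃ v (Icc a b))
    (hR : ∀ t ∈ Icc a b, ‖R t‖ ≤ K * T) (hM : ∀ t ∈ Icc a b, ‖M t‖ ≤ K)
    (hB : ∀ t ∈ Icc a b, ‖B t‖ ≤ K) (hB' : ∀ t ∈ Icc a b, ‖B' t‖ ≤ K)
    (hL : ∀ t ∈ Icc a b, ‖L t‖ ≤ K)
    (hPE : ∀ t ∈ Icc a b, ∀ y, μ * ‖y‖ ^ 2 ≤ inner ℝ y (Mavg t y))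
    (hq : ∀ t, ‖q t‖ ≤ ω t) (hr : ∀ t, ‖r t‖ ≤ ω t) (hω : IntervalIntegrable ω volume a b)
    (hdR : ∀ᵐ t, t ∈ Ioo a b → HasDerivAt R (M t - Mavg t) t)
    (hdχ : ∀ᵐ t, t ∈ Ioo a b → HasDerivAt χ (-(ε • M t (χ t)) + ε • B t (v t) + q t) t)
    (hdv : ∀ᵐ t, t ∈ Ioo a b →
      HasDerivAt v (-(γ • v t) - ε • B' t (χ t) + ε • L t (v t) + r t) t) :
    √(‖χ b‖ ^ 2 + ‖v b‖ ^ 2) ≤ √2 * Real.exp (-lam * (b - a)) * √(‖χ a‖ ^ 2 + ‖v a‖ ^ 2) +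
      4 * ∫ s in a..b, Real.exp (-lam * (b - s)) * ω s := by
  obtain ⟨C, hC⟩ := lipschitzOnWith_lyap (ε := ε) hRl hχl hvl
  have hω0 : ∀ t, 0 ≤ ω t := fun t => (norm_nonneg _).trans (hq t)
  have hlo : ∀ t ∈ Icc a b, 2 / 3 * (‖χ t‖ ^ 2 + ‖v t‖ ^ 2) ≤ lyap ε (R t) (χ t) (v t) :=
    fun t ht => le_lyap hε (hR t ht) h1 _ _
  have h0 : ∀ t ∈ Icc a b, 0 ≤ lyap ε (R t) (χ t) (v t) := fun t ht =>
    le_trans (by positivity) (hlo t ht)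
  have key := sqrt_le_of_ae_deriv_le (g := fun t => 9 / 4 * ω t) hab hlam hC h0
    (hω.const_mul _) (fun t => mul_nonneg (by norm_num) (hω0 t)) (by
      filter_upwards [hdR, hdχ, hdv] with t k1 k2 k3 ht
      have htI := Ioo_subset_Icc_self ht
      have d1 := k1 ht
      have d2 := k2 ht
      have d3 := k3 ht
      have d4 := (d2.norm_sq.add ((d2.inner ℝ (d1.clm_apply d2)).const_mul (2 * ε))).add d3.norm_sq
      refine ⟨_, d4, ?_⟩
      refine (lyap_deriv_le hε hμ hK hT h1 h2 h3 (hR t htI) (hM t htI) (hB t htI) (hB' t htI)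
        (hL t htI) (hPE t htI _) (hq t) (hr t) rfl rfl).trans ?_
      have := mul_le_mul_of_nonneg_right hlam' (h0 t htI)
      linarith)
  have hI : ∫ s in a..b, Real.exp (-lam * (b - s)) * (9 / 4 * ω s) =
      9 / 4 * ∫ s in a..b, Real.exp (-lam * (b - s)) * ω s := by
    rw [← intervalIntegral.integral_const_mul]; congr 1; ext s; ring
  have hI0 : 0 ≤ ∫ s in a..b, Real.exp (-lam * (b - s)) * ω s :=
    intervalIntegral.integral_nonneg hab fun s _ => mul_nonneg (Real.exp_pos _).le (hω0 s)
  simp only [hI] at key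
  have hb := hlo b (right_mem_Icc.2 hab)
  have haI := left_mem_Icc.2 hab
  have hup : lyap ε (R a) (χ a) (v a) ≤ 4 / 3 * (‖χ a‖ ^ 2 + ‖v a‖ ^ 2) := by
    have := lyap_le hε (hR a haI) (χ a) (v a)
    have h' := mul_le_mul_of_nonneg_right h1 (sq_nonneg ‖χ a‖)
    have h'' := sq_nonneg ‖v a‖
    linarith
  have s1 : √(‖χ b‖ ^ 2 + ‖v b‖ ^ 2) ≤ √(3 / 2) * √(lyap ε (R b) (χ b) (v b)) := by
    rw [← Real.sqrt_mul (by norm_num)]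
    exact Real.sqrt_le_sqrt (by linarith)
  have s2 : √(3 / 2) * √(lyap ε (R a) (χ a) (v a)) ≤ √2 * √(‖χ a‖ ^ 2 + ‖v a‖ ^ 2) := by
    rw [← Real.sqrt_mul (by norm_num), ← Real.sqrt_mul (by norm_num)]
    exact Real.sqrt_le_sqrt (by linarith)
  have s3 : √(3 / 2 : ℝ) ≤ 4 / 3 := Real.sqrt_le_iff.2 (by norm_num)
  have k := mul_le_mul_of_nonneg_left key (Real.sqrt_nonneg (3 / 2))
  have m1 := mul_le_mul_of_nonneg_left s2 (Real.exp_pos (-lam * (b - a))).le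
  have m2 := mul_le_mul_of_nonneg_right s3 hI0
  linear_combination s1 + k + m1 + 9 / 4 * m2 + hI0

end Lyapunov

/-! ### The averaging corrector -/

section Corrector

variable {A : Type*} [NormedAddCommGroup A] [NormedSpace ℝ A]

/-- `R(t) = F(t) - (1/T) ∫₀ᵀ F(t + s) ds` with `F(t) = ∫₀ᵗ M`: the bounded primitive of `M` minus its
moving average over windows of length `T`. -/
def corrector (M : ℝ → A) (T t : ℝ) : A :=
  (∫ s in (0 : ℝ)..t, M s) - T⁻¹ • ∫ s in (0 : ℝ)..T, ∫ r in (0 : ℝ)..(t + s), M r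

theorem norm_primitive_sub_le {M : ℝ → A} {K : ℝ} (hM : ∀ a b, IntervalIntegrable M volume a b)
    (hK : ∀ t, ‖M t‖ ≤ K) (s t : ℝ) :
    ‖(∫ r in (0 : ℝ)..s, M r) - ∫ r in (0 : ℝ)..t, M r‖ ≤ K * |s - t| := by
  rw [intervalIntegral.integral_interval_sub_left (hM _ _) (hM _ _)]
  exact intervalIntegral.norm_integral_le_of_norm_le_const fun r _ => hK r

theorem continuous_primitive_shift {M : ℝ → A} (hM : ∀ a b, IntervalIntegrable M volume a b)
    (t : ℝ) : Continuous fun s => ∫ r in (0 : ℝ)..(t + s), M r :=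
  (intervalIntegral.continuous_primitive hM 0).comp (continuous_const_add t)

theorem norm_corrector_le [CompleteSpace A] {M : ℝ → A} {K T : ℝ} (hT : 0 < T)
    (hM : ∀ a b, IntervalIntegrable M volume a b) (hK : ∀ t, ‖M t‖ ≤ K) (t : ℝ) :
    ‖corrector M T t‖ ≤ K * T := by
  have hK0 : 0 ≤ K := (norm_nonneg _).trans (hK 0)
  have e : corrector M T t = T⁻¹ • ∫ s in (0 : ℝ)..T,
      ((∫ r in (0 : ℝ)..t, M r) - ∫ r in (0 : ℝ)..(t + s), M r) := by
    rw [intervalIntegral.integral_sub intervalIntegrable_const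
      ((continuous_primitive_shift hM t).intervalIntegrable _ _), intervalIntegral.integral_const,
      smul_sub, smul_smul, sub_zero, inv_mul_cancel₀ hT.ne', one_smul, corrector]
  rw [e, norm_smul, norm_inv, Real.norm_of_nonneg hT.le, inv_mul_le_iff₀ hT]
  refine (intervalIntegral.norm_integral_le_of_norm_le_const (C := K * T) fun s hs => ?_).trans ?_
  · rw [uIoc_of_le hT.le] at hs
    refine (norm_primitive_sub_le hM hK _ _).trans ?_
    gcongr
    rw [abs_le]; constructor <;> linarith [hs.1, hs.2]
  · rw [sub_zero, abs_of_pos hT, mul_comm]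

theorem lipschitzWith_corrector {M : ℝ → A} {K T : ℝ} (hT : 0 < T)
    (hM : ∀ a b, IntervalIntegrable M volume a b) (hK : ∀ t, ‖M t‖ ≤ K) :
    LipschitzWith (2 * K).toNNReal (corrector M T) := by
  have hK0 : 0 ≤ K := (norm_nonneg _).trans (hK 0)
  refine LipschitzWith.of_dist_le_mul fun s t => ?_
  rw [dist_eq_norm, Real.dist_eq, Real.coe_toNNReal _ (by positivity)]
  have h1 : ‖T⁻¹ • ((∫ r in (0 : ℝ)..T, ∫ q in (0 : ℝ)..(s + r), M q) -
      ∫ r in (0 : ℝ)..T, ∫ q in (0 : ℝ)..(t + r), M q)‖ ≤ K * |s - t| := by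
    rw [← intervalIntegral.integral_sub ((continuous_primitive_shift hM s).intervalIntegrable _ _)
      ((continuous_primitive_shift hM t).intervalIntegrable _ _), norm_smul, norm_inv,
      Real.norm_of_nonneg hT.le, inv_mul_le_iff₀ hT]
    refine (intervalIntegral.norm_integral_le_of_norm_le_const (C := K * |s - t|)
      fun r _ => ?_).trans ?_
    · simpa using norm_primitive_sub_le hM hK (s + r) (t + r)
    · rw [sub_zero, abs_of_pos hT, mul_comm]
  have h2 := norm_primitive_sub_le hM hK s t
  unfold corrector
  rw [sub_sub_sub_comm, ← smul_sub]
  refine (norm_sub_le _ _).trans ?_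
  linarith

/-- The corrector converts `M` into its moving average, up to a total derivative. -/
theorem ae_hasDerivAt_corrector [CompleteSpace A] {M : ℝ → A} (T : ℝ)
    (hM : ∀ a b, IntervalIntegrable M volume a b) (hloc : LocallyIntegrable M volume) :
    ∀ᵐ t, HasDerivAt (corrector M T) (M t - T⁻¹ • ∫ s in t..(t + T), M s) t := by
  filter_upwards [LocallyIntegrable.ae_hasDerivAt_integral hloc] with t ht
  have hF : Continuous fun s => ∫ r in (0 : ℝ)..s, M r :=
    intervalIntegral.continuous_primitive hM 0
  have hshift : (fun t => ∫ s in (0 : ℝ)..T, ∫ r in (0 : ℝ)..(t + s), M r) = fun t =>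
      (∫ s in (0 : ℝ)..(t + T), ∫ r in (0 : ℝ)..s, M r) -
        ∫ s in (0 : ℝ)..t, ∫ r in (0 : ℝ)..s, M r := by
    ext t
    rw [intervalIntegral.integral_comp_add_left (fun s => ∫ r in (0 : ℝ)..s, M r),
      intervalIntegral.integral_interval_sub_left (hF.intervalIntegrable _ _)
        (hF.intervalIntegrable _ _), add_zero]
  have d1 := intervalIntegral.integral_hasDerivAt_right (hF.intervalIntegrable 0 (t + T))
    (hF.stronglyMeasurableAtFilter _ _) hF.continuousAt
  have d2 := intervalIntegral.integral_hasDerivAt_right (hF.intervalIntegrable 0 t)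
    (hF.stronglyMeasurableAtFilter _ _) hF.continuousAt
  have d3 := (d1.comp_add_const t T).sub d2
  have d4 := (ht 0).sub (d3.const_smul T⁻¹)
  rw [intervalIntegral.integral_interval_sub_left (hM _ _) (hM _ _)] at d4
  refine d4.congr_of_eventuallyEq (Eventually.of_forall fun s => ?_)
  rw [corrector, congrFun hshift s]
  rfl

end Corrector

/-! ### Exponential smoothing of `L_p` signals -/

section Smoothing

open ProbabilityTheory ENNReal

/-- The weight `s ↦ λ e^{-λ (t - s)}`, for `s ≤ t`, on the window `[a, b]`. -/
def expWeight (lam a b t : ℝ) : Measure ℝ :=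
  (volume.restrict (Icc a b)).withDensity fun s => exponentialPDF lam (t - s)

theorem measurable_exponentialPDF_sub (lam : ℝ) :
    Measurable fun z : ℝ × ℝ => exponentialPDF lam (z.1 - z.2) :=
  ((measurable_exponentialPDFReal lam).ennreal_ofReal).comp (measurable_fst.sub measurable_snd)

theorem measurable_exponentialPDF_sub_right (lam t : ℝ) :
    Measurable fun s : ℝ => exponentialPDF lam (t - s) :=
  (measurable_exponentialPDF_sub lam).comp measurable_prodMk_left

theorem measurable_exponentialPDF_sub_left (lam s : ℝ) :
    Measurable fun t : ℝ => exponentialPDF lam (t - s) :=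
  (measurable_exponentialPDF_sub lam).comp measurable_prodMk_right

theorem expWeight_univ_le {lam : ℝ} (hlam : 0 < lam) (a b t : ℝ) :
    expWeight lam a b t univ ≤ 1 := by
  rw [expWeight, withDensity_apply _ MeasurableSet.univ, Measure.restrict_univ]
  refine (setLIntegral_le_lintegral _ _).trans_eq ?_
  rw [lintegral_sub_left_eq_self (fun s => exponentialPDF lam s) t]
  exact lintegral_exponentialPDF_eq_one hlam

variable {E : Type*} [NormedAddCommGroup E] {u : ℝ → E} {lam a b : ℝ} {p : ℝ≥0∞}

/-- The response of a first-order lag with rate `lam`, started at time `a`, to the signal `‖u‖`. -/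
def expConv (lam a : ℝ) (u : ℝ → E) (t : ℝ) : ℝ :=
  ∫ s in a..t, Real.exp (-lam * (t - s)) * ‖u s‖

/-- Jensen's inequality for the weight, whose total mass is at most `1`. -/
theorem ofReal_expConv_le (hlam : 0 < lam) (hu : IntegrableOn u (Icc a b)) {t : ℝ}
    (ht : t ∈ Icc a b) (hp : 1 ≤ p) :
    ENNReal.ofReal (lam * expConv lam a u t) ≤ eLpNorm u p (expWeight lam a b t) := by
  have hac : expWeight lam a b t ≪ volume.restrict (Icc a b) := withDensity_absolutelyContinuous _ _
  have hsub : Ioc a t ⊆ Icc a b := fun s hs => ⟨hs.1.le, hs.2.trans ht.2⟩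
  have hint : IntegrableOn (fun s => lam * (Real.exp (-lam * (t - s)) * ‖u s‖)) (Ioc a t) := by
    refine Integrable.const_mul ?_ _
    have h1 : IntervalIntegrable (fun s => ‖u s‖) volume a t :=
      (intervalIntegrable_iff_integrableOn_Ioc_of_le ht.1).2 (hu.mono_set hsub).norm
    exact (h1.continuousOn_mul (by fun_prop)).1
  have h1 : ENNReal.ofReal (lam * expConv lam a u t) ≤ ∫⁻ s, ‖u s‖ₑ ∂(expWeight lam a b t) := by
    rw [expConv, intervalIntegral.integral_of_le ht.1, ← integral_const_mul,
      ofReal_integral_eq_lintegral_ofReal hint (Eventually.of_forall fun s => by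
        simp only [Pi.zero_apply]; positivity), expWeight,
      lintegral_withDensity_eq_lintegral_mul₀ (measurable_exponentialPDF_sub_right lam t).aemeasurable
        hu.aestronglyMeasurable.enorm]
    refine le_trans ?_ (lintegral_mono_set hsub)
    refine setLIntegral_mono' measurableSet_Ioc fun s hs => ?_
    rw [Pi.mul_apply, exponentialPDF_of_nonneg (sub_nonneg.2 hs.2), ← ofReal_norm,
      ← ENNReal.ofReal_mul (by positivity)]
    apply le_of_eq; congr 1; ring_nf
  rw [← eLpNorm_one_eq_lintegral_enorm] at h1
  refine h1.trans ((eLpNorm_le_eLpNorm_mul_rpow_measure_univ hp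
    (hu.aestronglyMeasurable.mono_ac hac)).trans ?_)
  refine mul_le_of_le_one_right' (ENNReal.rpow_le_one (expWeight_univ_le hlam a b t) ?_)
  rw [ENNReal.toReal_one, div_one, sub_nonneg]
  rcases eq_or_ne p ∞ with rfl | hpt
  · simp
  · have : 1 ≤ p.toReal := by simpa using ENNReal.toReal_mono hpt hp
    exact (div_le_one (by linarith)).2 this

/-- The smoothed signal is bounded, at each time, by the `L_p` norm of its past: for `lam ≤ 1` the
weight is dominated by Lebesgue measure. -/
theorem ofReal_expConv_le_eLpNorm (hlam : 0 < lam) (hlam1 : lam ≤ 1)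
    (hu : IntegrableOn u (Icc a b)) (hab : a ≤ b) (hp : 1 ≤ p) :
    ENNReal.ofReal (lam * expConv lam a u b) ≤ eLpNorm u p (volume.restrict (Icc a b)) := by
  refine (ofReal_expConv_le hlam hu (right_mem_Icc.2 hab) hp).trans (eLpNorm_mono_measure _ ?_)
  have h : expWeight lam a b b ≤ (volume.restrict (Icc a b)).withDensity 1 := by
    refine withDensity_mono (Eventually.of_forall fun s => ?_)
    change exponentialPDF lam (b - s) ≤ 1
    rcases le_or_gt 0 (b - s) with h | h
    · rw [exponentialPDF_of_nonneg h, ← ENNReal.ofReal_one]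
      refine ENNReal.ofReal_le_ofReal (mul_le_one₀ hlam1 (Real.exp_pos _).le ?_)
      exact Real.exp_le_one_iff.2 (neg_nonpos.2 (by positivity))
    · rw [exponentialPDF_of_neg h]; exact zero_le
  rwa [withDensity_one] at h

/-- Young's inequality for the exponential kernel. -/
theorem eLpNorm_expConv_le (hlam : 0 < lam) (hu : IntegrableOn u (Icc a b)) (hp : 1 ≤ p) :
    eLpNorm (fun t => lam * expConv lam a u t) p (volume.restrict (Icc a b)) ≤
      eLpNorm u p (volume.restrict (Icc a b)) := by
  have h0 : ∀ t ∈ Icc a b, ‖lam * expConv lam a u t‖ₑ ≤ eLpNorm u p (expWeight lam a b t) := by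
    intro t ht
    refine le_trans (le_of_eq ?_) (ofReal_expConv_le hlam hu ht hp)
    rw [← ofReal_norm, Real.norm_of_nonneg]
    exact mul_nonneg hlam.le (intervalIntegral.integral_nonneg ht.1 fun s _ => by positivity)
  rcases eq_or_ne p ∞ with rfl | hpt
  · rw [eLpNorm_exponent_top]
    refine essSup_le_of_ae_le _ ?_
    refine (ae_restrict_iff' measurableSet_Icc).2 (Eventually.of_forall fun t ht => ?_)
    refine (h0 t ht).trans ?_
    rw [eLpNorm_exponent_top, eLpNorm_exponent_top]
    exact eLpNormEssSup_mono_measure _ (withDensity_absolutelyContinuous _ _)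
  · have hp0 : p ≠ 0 := (zero_lt_one.trans_le hp).ne'
    have hpr : 0 < p.toReal := ENNReal.toReal_pos hp0 hpt
    simp only [eLpNorm_eq_lintegral_rpow_enorm_toReal hp0 hpt] at h0 ⊢
    refine ENNReal.rpow_le_rpow ?_ (by positivity)
    set g : ℝ → ℝ≥0∞ := fun s => ‖u s‖ₑ ^ p.toReal
    have hg : AEMeasurable g (volume.restrict (Icc a b)) :=
      hu.aestronglyMeasurable.enorm.pow_const _
    calc ∫⁻ t in Icc a b, ‖lam * expConv lam a u t‖ₑ ^ p.toReal
        ≤ ∫⁻ t in Icc a b, ∫⁻ s in Icc a b, exponentialPDF lam (t - s) * g s := by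
          refine setLIntegral_mono' measurableSet_Icc fun t ht => ?_
          refine (ENNReal.rpow_le_rpow (h0 t ht) hpr.le).trans_eq ?_
          rw [← ENNReal.rpow_mul, one_div, inv_mul_cancel₀ hpr.ne', ENNReal.rpow_one, expWeight,
            lintegral_withDensity_eq_lintegral_mul₀
              (measurable_exponentialPDF_sub_right lam t).aemeasurable hg]
          rfl
      _ = ∫⁻ s in Icc a b, ∫⁻ t in Icc a b, exponentialPDF lam (t - s) * g s := by
          refine lintegral_lintegral_swap ?_
          exact (measurable_exponentialPDF_sub lam).aemeasurable.mul hg.comp_snd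
      _ ≤ ∫⁻ s in Icc a b, g s := by
          refine lintegral_mono fun s => ?_
          rw [lintegral_mul_const _ (measurable_exponentialPDF_sub_left lam s)]
          refine mul_le_of_le_one_left' ((setLIntegral_le_lintegral _ _).trans_eq ?_)
          rw [lintegral_sub_right_eq_self (fun t => exponentialPDF lam t) s]
          exact lintegral_exponentialPDF_eq_one hlam

theorem continuousOn_expConv (hu : IntegrableOn u (Icc a b)) :
    ContinuousOn (expConv lam a u) (Icc a b) := by
  have h : ∀ t, expConv lam a u t =
      Real.exp (-lam * t) * ∫ s in a..t, Real.exp (lam * s) * ‖u s‖ := by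
    intro t
    rw [expConv, ← intervalIntegral.integral_const_mul]
    congr 1; ext s
    rw [← mul_assoc, ← Real.exp_add]; congr 2; ring
  simp only [funext h]
  refine ContinuousOn.mul (by fun_prop) ?_
  rcases lt_or_ge b a with hab | hab
  · simp [Icc_eq_empty_of_lt hab]
  rw [← uIcc_of_le hab] at hu ⊢
  refine intervalIntegral.continuousOn_primitive_interval ?_
  rw [uIcc_of_le hab] at hu ⊢
  exact IntegrableOn.continuousOn_mul (by fun_prop) hu.norm isCompact_Icc

/-- A decaying exponential is in every `L_p`. -/
theorem exists_eLpNorm_exp_le (hlam : 0 < lam) (a : ℝ) (hp : 1 ≤ p) :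
    ∃ B : NNReal, ∀ b, eLpNorm (fun t => Real.exp (-lam * (t - a))) p (volume.restrict (Icc a b)) ≤
      B := by
  have hle : ∀ t, a ≤ t → ‖Real.exp (-lam * (t - a))‖ₑ ≤ 1 := by
    intro t ht
    rw [← ofReal_norm, Real.norm_of_nonneg (Real.exp_pos _).le, ← ENNReal.ofReal_one]
    exact ENNReal.ofReal_le_ofReal (Real.exp_le_one_iff.2 (by nlinarith))
  rcases eq_or_ne p ∞ with rfl | hpt
  · refine ⟨1, fun b => ?_⟩
    rw [eLpNorm_exponent_top]
    refine essSup_le_of_ae_le _ ?_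
    exact (ae_restrict_iff' measurableSet_Icc).2 (Eventually.of_forall fun t ht => hle t ht.1)
  · have hp0 : p ≠ 0 := (zero_lt_one.trans_le hp).ne'
    have hp1 : 1 ≤ p.toReal := by simpa using ENNReal.toReal_mono hpt hp
    have hfin : ENNReal.ofReal (1 / lam) ^ (1 / p.toReal) ≠ ∞ :=
      ENNReal.rpow_ne_top_of_nonneg (by positivity) ENNReal.ofReal_ne_top
    refine ⟨(ENNReal.ofReal (1 / lam) ^ (1 / p.toReal)).toNNReal, fun b => ?_⟩
    rw [ENNReal.coe_toNNReal hfin, eLpNorm_eq_lintegral_rpow_enorm_toReal hp0 hpt]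
    refine ENNReal.rpow_le_rpow ?_ (by positivity)
    calc ∫⁻ t in Icc a b, ‖Real.exp (-lam * (t - a))‖ₑ ^ p.toReal
        ≤ ∫⁻ t in Icc a b, ENNReal.ofReal (1 / lam) * exponentialPDF lam (t - a) := by
          refine setLIntegral_mono' measurableSet_Icc fun t ht => ?_
          refine (ENNReal.rpow_le_rpow_of_exponent_ge (hle t ht.1) hp1).trans_eq ?_
          rw [ENNReal.rpow_one, ← ofReal_norm, Real.norm_of_nonneg (Real.exp_pos _).le,
            exponentialPDF_of_nonneg (sub_nonneg.2 ht.1), ← ENNReal.ofReal_mul (by positivity)]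
          congr 1
          rw [← mul_assoc, one_div, inv_mul_cancel₀ hlam.ne', one_mul, neg_mul]
      _ ≤ ENNReal.ofReal (1 / lam) := by
          rw [lintegral_const_mul _ (measurable_exponentialPDF_sub_left lam a)]
          refine mul_le_of_le_one_right' ((setLIntegral_le_lintegral _ _).trans_eq ?_)
          rw [lintegral_sub_right_eq_self (fun t => exponentialPDF lam t) a]
          exact lintegral_exponentialPDF_eq_one hlam

end Smoothing

/-! ### Matrices acting on Euclidean vectors -/

section Act

variable {l m n : Type*} [Fintype n]

theorem act_add_matrix (A B : Matrix m n ℝ) (x : EuclideanSpace ℝ n) :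
    act (A + B) x = act A x + act B x := by
  ext i; simp [act, Matrix.add_mulVec]

theorem act_neg_matrix (A : Matrix m n ℝ) (x : EuclideanSpace ℝ n) :
    act (-A) x = -act A x := by
  ext i; simp [act, Matrix.neg_mulVec]

theorem act_smul_matrix (c : ℝ) (A : Matrix m n ℝ) (x : EuclideanSpace ℝ n) :
    act (c • A) x = c • act A x := by
  ext i; simp [act, Matrix.smul_mulVec]

theorem act_one [DecidableEq n] (x : EuclideanSpace ℝ n) : act (1 : Matrix n n ℝ) x = x := by
  ext i; simp [act]

theorem act_add (A : Matrix m n ℝ) (x y : EuclideanSpace ℝ n) :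
    act A (x + y) = act A x + act A y := by
  ext i; simp [act, Matrix.mulVec_add]

theorem act_fromRows (A : Matrix l n ℝ) (B : Matrix m n ℝ) (x : EuclideanSpace ℝ n) :
    act (Matrix.fromRows A B) x = stack (act A x) (act B x) := by
  ext i; cases i <;> simp [act, stack, Matrix.fromRows_mulVec]

variable [Fintype m]

theorem act_mul (A : Matrix l m ℝ) (B : Matrix m n ℝ) (x : EuclideanSpace ℝ n) :
    act (A * B) x = act A (act B x) := by
  ext i; simp [act, Matrix.mulVec_mulVec]

theorem act_fromCols_stack (A : Matrix l m ℝ) (B : Matrix l n ℝ) (a : EuclideanSpace ℝ m)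
    (b : EuclideanSpace ℝ n) : act (Matrix.fromCols A B) (stack a b) = act A a + act B b := by
  ext i; simp [act, stack, Matrix.fromCols_mulVec]

/-- `act M` as a continuous linear map. -/
def actL [DecidableEq n] (M : Matrix m n ℝ) : EuclideanSpace ℝ n →L[ℝ] EuclideanSpace ℝ m :=
  LinearMap.toContinuousLinearMap (Matrix.toEuclideanLin M)

theorem actL_apply [DecidableEq n] (M : Matrix m n ℝ) (x : EuclideanSpace ℝ n) :
    actL M x = act M x := rfl

theorem inner_eq_dotProduct (x y : EuclideanSpace ℝ n) :
    inner ℝ x y = WithLp.ofLp x ⬝ᵥ WithLp.ofLp y := by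
  simp [PiLp.inner_apply, dotProduct, mul_comm]

theorem inner_act_left (A : Matrix m n ℝ) (x : EuclideanSpace ℝ n) (y : EuclideanSpace ℝ m) :
    inner ℝ (act A x) y = inner ℝ x (act Aᵀ y) := by
  simp only [inner_eq_dotProduct, act]
  rw [Matrix.mulVec_transpose, dotProduct_comm, Matrix.dotProduct_mulVec, dotProduct_comm]

theorem norm_act_eq [DecidableEq n] {A : Matrix m n ℝ} (hA : Aᵀ * A = 1) (x : EuclideanSpace ℝ n) :
    ‖act A x‖ = ‖x‖ := by
  have : ‖act A x‖ ^ 2 = ‖x‖ ^ 2 := by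
    rw [← real_inner_self_eq_norm_sq, ← real_inner_self_eq_norm_sq, inner_act_left, ← act_mul, hA,
      act_one]
  exact (pow_left_inj₀ (norm_nonneg _) (norm_nonneg _) two_ne_zero).1 this

theorem norm_act_le_norm [DecidableEq m] {A : Matrix m n ℝ} (hA : A * Aᵀ = 1)
    (x : EuclideanSpace ℝ n) : ‖act A x‖ ≤ ‖x‖ := by
  have h1 : ‖act A x‖ * ‖act A x‖ ≤ ‖x‖ * ‖act A x‖ := by
    calc ‖act A x‖ * ‖act A x‖ = inner ℝ x (act Aᵀ (act A x)) := by
          rw [← inner_act_left, real_inner_self_eq_norm_mul_norm]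
      _ ≤ ‖x‖ * ‖act Aᵀ (act A x)‖ := real_inner_le_norm _ _
      _ = ‖x‖ * ‖act A x‖ := by rw [norm_act_eq (by simpa using hA)]
  rcases (norm_nonneg (act A x)).eq_or_lt with h | h
  · rw [← h]; exact norm_nonneg x
  · exact le_of_mul_le_mul_right h1 h

theorem norm_act_le_opNorm [DecidableEq n] (A : Matrix n n ℝ) (x : EuclideanSpace ℝ n) :
    ‖act A x‖ ≤ opNorm A * ‖x‖ :=
  (Matrix.toEuclideanCLM (n := n) (𝕜 := ℝ) A).le_opNorm x

theorem opNorm_nonneg [DecidableEq n] (A : Matrix n n ℝ) : 0 ≤ opNorm A := norm_nonneg _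

theorem norm_sq_stack (a : EuclideanSpace ℝ m) (b : EuclideanSpace ℝ n) :
    ‖stack a b‖ ^ 2 = ‖a‖ ^ 2 + ‖b‖ ^ 2 := by
  simp [EuclideanSpace.norm_sq_eq, stack]

theorem norm_stack (a : EuclideanSpace ℝ m) (b : EuclideanSpace ℝ n) :
    ‖stack a b‖ = √(‖a‖ ^ 2 + ‖b‖ ^ 2) := by
  rw [← norm_sq_stack, Real.sqrt_sq (norm_nonneg _)]

theorem norm_actL_mul_le [Fintype l] {r K : ℝ} [DecidableEq m] [DecidableEq n] {A : Matrix l m ℝ}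
    {B : Matrix m n ℝ} (hA : ∀ x, ‖act A x‖ ≤ r * ‖x‖) (hr : 0 ≤ r) (hB : ‖actL B‖ ≤ K) :
    ‖actL (A * B)‖ ≤ r * K := by
  have hK := (norm_nonneg _).trans hB
  refine ContinuousLinearMap.opNorm_le_bound _ (by positivity) fun x => ?_
  rw [actL_apply, act_mul, mul_assoc]
  exact (hA _).trans (by gcongr; exact (actL B).le_of_opNorm_le hB x)

end Act

theorem attackDir_transpose_mul {N : ℕ} (adv : Finset (Fin N)) :
    (attackDir adv)ᵀ * attackDir adv = 1 := by
  ext i j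
  simp only [Matrix.mul_apply, Matrix.transpose_apply, attackDir, Matrix.of_apply, Matrix.one_apply,
    ite_mul, one_mul, zero_mul, Finset.sum_ite_eq', Finset.mem_univ, if_true, Subtype.ext_iff]

/-! ### Switching networks -/

/-- There are finitely many graphs on `N` nodes, so any constant will do. -/
theorem exists_lap_bound (N : ℕ) :
    ∃ K : ℝ, 0 < K ∧ ∀ G : SimpleGraph (Fin N), ‖actL (lap G)‖ ≤ K := by
  obtain ⟨K, hK⟩ := Finite.bddAbove_range fun G : SimpleGraph (Fin N) => ‖actL (lap G)‖
  exact ⟨max K 1, by positivity, fun G => (hK ⟨G, rfl⟩).trans (le_max_left _ _)⟩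

theorem lap_mul_transpose_mul {N : ℕ} {Q : Matrix (Fin (N - 1)) (Fin N) ℝ}
    (hQ : IsDisagreementMatrix Q) (G : SimpleGraph (Fin N)) : lap G * Qᵀ * Q = lap G := by
  have h : lap G * Matrix.of (fun _ _ => (1 : ℝ)) = 0 := by
    ext i j
    classical
    have := congrFun (SimpleGraph.lapMatrix_mulVec_const_eq_zero (R := ℝ) (G := G)) i
    simp only [Matrix.mulVec, dotProduct] at this
    simp only [lap, Matrix.mul_apply, Matrix.of_apply, Matrix.zero_apply]
    simpa using this
  rw [Matrix.mul_assoc, hQ.transpose_mul, Matrix.mul_sub, Matrix.mul_one, Matrix.mul_smul, h,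
    smul_zero, sub_zero]

/-- Off the finitely many switching times of a bounded interval, a function of the mode is locally
constant. Times are clamped to `t ≥ 0`, where alone the signal is constrained. -/
theorem SwitchingNetwork.aestronglyMeasurable {N : ℕ} (net : SwitchingNetwork N) {A : Type*}
    [NormedAddCommGroup A] (g : Fin net.modes → A) :
    AEStronglyMeasurable (fun t => g (net.signal (max t 0))) volume := by
  have hb : ∀ n : ℕ, AEStronglyMeasurable (fun t => g (net.signal (max t 0)))
      (volume.restrict (Iio (n : ℝ))) := by
    intro n
    obtain ⟨S, hS⟩ := net.finite_switching n
    have hms : MeasurableSet (Iio (n : ℝ) \ (S : Set ℝ)) :=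
      measurableSet_Iio.diff S.measurableSet
    have hopen : IsOpen (Iio (n : ℝ) \ (S : Set ℝ)) :=
      isOpen_Iio.sdiff S.finite_toSet.isClosed
    have hcont : ContinuousOn (fun t => g (net.signal (max t 0))) (Iio (n : ℝ) \ (S : Set ℝ)) := by
      intro t ht
      obtain ⟨δ, hδ, hball⟩ := Metric.isOpen_iff.1 hopen t ht
      have hstep : ∀ r s, r ∈ Metric.ball t δ → s ∈ Metric.ball t δ → r ≤ s →
          net.signal (max r 0) = net.signal (max s 0) := by
        intro r s hr hs hrs
        have hsn : s < n := (hball hs).1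
        rcases le_or_gt s 0 with h | h
        · rw [max_eq_right h, max_eq_right (hrs.trans h)]
        refine hS _ _ (le_max_right _ _) (max_le_max_right _ hrs) (max_le hsn.le (h.trans hsn).le) ?_
        intro q hq hqI
        rw [max_eq_left h.le] at hqI
        have hrq : r < q := (le_max_left _ _).trans_lt hqI.1
        rw [Real.ball_eq_Ioo] at hr hs hball
        exact (hball ⟨hr.1.trans hrq, hqI.2.trans_lt hs.2⟩).2 hq
      refine ContinuousAt.continuousWithinAt ?_
      refine (continuousAt_const (y := g (net.signal (max t 0)))).congr ?_
      filter_upwards [Metric.ball_mem_nhds t hδ] with s hs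
      rcases le_total s t with h | h
      · rw [hstep s t hs (Metric.mem_ball_self hδ) h]
      · rw [hstep t s (Metric.mem_ball_self hδ) hs h]
    have h1 := hcont.aestronglyMeasurable (μ := volume) hms
    rwa [Measure.restrict_congr_set (sdiff_null_ae_eq_self (S.finite_toSet.measure_zero volume))]
      at h1
  have hU : (⋃ n : ℕ, Iio (n : ℝ)) = univ := by
    ext t; simpa using exists_nat_gt t
  rw [← Measure.restrict_univ (μ := volume), ← hU]
  exact AEStronglyMeasurable.iUnion hb

theorem SwitchingNetwork.locallyIntegrable {N : ℕ} (net : SwitchingNetwork N) {A : Type*}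
    [NormedAddCommGroup A] (g : Fin net.modes → A) :
    LocallyIntegrable (fun t => g (net.signal (max t 0))) volume := by
  obtain ⟨K, hK⟩ := Finite.bddAbove_range fun k => ‖g k‖
  exact (memLp_top_of_bound (net.aestronglyMeasurable g) K
    (Eventually.of_forall fun t => hK ⟨_, rfl⟩)).locallyIntegrable le_top

theorem SwitchingNetwork.intervalIntegrable {N : ℕ} (net : SwitchingNetwork N) {A : Type*}
    [NormedAddCommGroup A] (g : Fin net.modes → A) (a b : ℝ) :
    IntervalIntegrable (fun t => g (net.signal (max t 0))) volume a b :=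
  intervalIntegrable_iff.2 (((net.locallyIntegrable g).integrableOn_isCompact
    isCompact_uIcc).mono_set uIoc_subset_uIcc)

/-! ### The closed loop in the coordinates `χ = γ Q p̃ + Q v` and `v` -/

/-- `x ↦ γ Q p̃ + Q v`. -/
def chiMat {N : ℕ} (Q : Matrix (Fin (N - 1)) (Fin N) ℝ) (γ : ℝ) :
    Matrix (Fin (N - 1)) (Fin N ⊕ Fin N) ℝ :=
  Matrix.fromCols (γ • Q) Q

/-- `x ↦ v`. -/
def velMat (N : ℕ) : Matrix (Fin N) (Fin N ⊕ Fin N) ℝ := Matrix.fromCols 0 1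

section Coordinates

variable {N : ℕ} {Q : Matrix (Fin (N - 1)) (Fin N) ℝ}

/-- In these coordinates `χ` decays at the slow rate `α / γ` only, and `v` at the fast rate `γ`. -/
theorem chiMat_mul_sysMatrix (hQ : IsDisagreementMatrix Q) (G : SimpleGraph (Fin N)) {α γ : ℝ}
    (hγ : γ ≠ 0) :
    chiMat Q γ * sysMatrix G α γ =
      -((α / γ) • ((Q * lap G * Qᵀ) * chiMat Q γ)) + (α / γ) • ((Q * lap G) * velMat N) := by
  have h : Q * lap G * Qᵀ * Q = Q * lap G := by
    rw [Matrix.mul_assoc Q, Matrix.mul_assoc Q, lap_mul_transpose_mul hQ]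
  rw [chiMat, velMat, sysMatrix, Matrix.fromCols_mul_fromBlocks, Matrix.mul_fromCols,
    Matrix.mul_fromCols, Matrix.mul_smul, h]
  ext i j
  rcases j with j | j
  · simp [Matrix.mul_apply, Finset.mul_sum]
    field_simp
  · simp

theorem velMat_mul_sysMatrix (hQ : IsDisagreementMatrix Q) (G : SimpleGraph (Fin N)) {α γ : ℝ}
    (hγ : γ ≠ 0) :
    velMat N * sysMatrix G α γ =
      -(γ • velMat N) + -((α / γ) • ((lap G * Qᵀ) * chiMat Q γ)) +
        (α / γ) • (lap G * velMat N) := by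
  rw [chiMat, velMat, sysMatrix, Matrix.fromCols_mul_fromBlocks, Matrix.mul_fromCols,
    Matrix.mul_fromCols, Matrix.mul_smul, lap_mul_transpose_mul hQ]
  ext i j
  rcases j with j | j
  · simp
    field_simp
  · simp

theorem chiMat_mul_inputMatrix (γ : ℝ) (adv : Finset (Fin N)) :
    chiMat Q γ * inputMatrix adv = Q * attackDir adv := by
  rw [chiMat, inputMatrix, Matrix.fromCols_mul_fromRows, Matrix.mul_zero, zero_add]

theorem velMat_mul_inputMatrix (adv : Finset (Fin N)) :
    velMat N * inputMatrix adv = attackDir adv := by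
  rw [velMat, inputMatrix, Matrix.fromCols_mul_fromRows, Matrix.mul_zero, zero_add, Matrix.one_mul]

theorem Cmat_inv {γ : ℝ} (hγ : γ ≠ 0) :
    (Cmat Q γ)⁻¹ = Matrix.fromBlocks (γ • 1) Q 0 1 := by
  refine Matrix.inv_eq_right_inv ?_
  rw [Cmat, Matrix.fromBlocks_multiply, ← Matrix.fromBlocks_one]
  congr 1 <;> simp [smul_smul, hγ]

theorem stack_coordinates {γ : ℝ} (hγ : γ ≠ 0) (x : EuclideanSpace ℝ (Fin N ⊕ Fin N)) :
    stack (act (chiMat Q γ) x) (act (velMat N) x) = act (Cmat Q γ)⁻¹ (output Q x) := by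
  rw [← act_fromRows, output, ← act_mul, Cmat_inv hγ, Matrix.fromBlocks_multiply, chiMat, velMat,
    Matrix.fromRows_fromCols_eq_fromBlocks]
  simp

theorem output_eq {γ : ℝ} (hγ : γ ≠ 0) (x : EuclideanSpace ℝ (Fin N ⊕ Fin N)) :
    output Q x = act (Cmat Q γ) (stack (act (chiMat Q γ) x) (act (velMat N) x)) := by
  have h : Cmat Q γ * (Cmat Q γ)⁻¹ = 1 := by
    rw [Cmat_inv hγ, Cmat, Matrix.fromBlocks_multiply, ← Matrix.fromBlocks_one]
    congr 1 <;> simp [smul_smul, hγ]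
  rw [stack_coordinates hγ, ← act_mul, h, act_one]

theorem output_stack (p v : EuclideanSpace ℝ (Fin N)) :
    output Q (stack p v) = stack (act Q p) v := by
  rw [output, ← Matrix.fromRows_fromCols_eq_fromBlocks, act_fromRows, act_fromCols_stack,
    act_fromCols_stack]
  congr 1 <;> ext i <;> simp [act]

theorem stack_components (x : EuclideanSpace ℝ (Fin N ⊕ Fin N)) :
    ∃ p v : EuclideanSpace ℝ (Fin N), x = stack p v :=
  ⟨WithLp.toLp 2 fun i => x (Sum.inl i), WithLp.toLp 2 fun i => x (Sum.inr i), by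
    ext i; cases i <;> simp [stack]⟩

theorem norm_output_le (hQ : IsDisagreementMatrix Q) (x : EuclideanSpace ℝ (Fin N ⊕ Fin N)) :
    ‖output Q x‖ ≤ ‖x‖ := by
  obtain ⟨p, v, rfl⟩ := stack_components x
  rw [output_stack, norm_stack, norm_stack]
  have := norm_act_le_norm hQ.mul_transpose p
  gcongr

end Coordinates

/-! ### Persistent excitation -/

section Excitation

variable {N : ℕ} (net : SwitchingNetwork N) (Q : Matrix (Fin (N - 1)) (Fin N) ℝ)

/-- `Q L_{σ(t)} Qᵀ` as an operator, extended by its value at `0` to negative times. -/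
def reducedLap (t : ℝ) : EuclideanSpace ℝ (Fin (N - 1)) →L[ℝ] EuclideanSpace ℝ (Fin (N - 1)) :=
  actL (Q * lap (net.graphAt (max t 0)) * Qᵀ)

theorem locallyIntegrable_reducedLap : LocallyIntegrable (reducedLap net Q) volume :=
  net.locallyIntegrable fun k => actL (Q * lap (net.graph k) * Qᵀ)

theorem intervalIntegrable_reducedLap (a b : ℝ) :
    IntervalIntegrable (reducedLap net Q) volume a b :=
  net.intervalIntegrable (fun k => actL (Q * lap (net.graph k) * Qᵀ)) a b

theorem act_avgLap {T t : ℝ} (hT : 0 ≤ T) (ht : 0 ≤ t) (y : EuclideanSpace ℝ (Fin (N - 1))) :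
    act (avgLap net Q T t) y = (T⁻¹ • ∫ s in t..(t + T), reducedLap net Q s) y := by
  have hI : IntervalIntegrable (reducedLap net Q) volume t (t + T) :=
    intervalIntegrable_reducedLap net Q _ _
  ext i
  rw [_root_.smul_apply, ContinuousLinearMap.intervalIntegral_apply hI y]
  have hIy : IntervalIntegrable (fun s => reducedLap net Q s y) volume t (t + T) :=
    net.intervalIntegrable (fun k => actL (Q * lap (net.graph k) * Qᵀ) y) _ _
  have h1 := ContinuousLinearMap.intervalIntegral_comp_comm
    (EuclideanSpace.proj i : EuclideanSpace ℝ (Fin (N - 1)) →L[ℝ] ℝ) hIy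
  simp only [EuclideanSpace.coe_proj] at h1
  rw [PiLp.smul_apply, ← h1, smul_eq_mul]
  have h2 : ∀ s, (reducedLap net Q s y) i =
      ∑ j, (Q * lap (net.graphAt (max s 0)) * Qᵀ) i j * y j := fun s => rfl
  simp only [h2]
  have h3 : ∫ s in t..(t + T), ∑ j, (Q * lap (net.graphAt (max s 0)) * Qᵀ) i j * y j =
      ∑ j, ∫ s in t..(t + T), (Q * lap (net.graphAt (max s 0)) * Qᵀ) i j * y j :=
    intervalIntegral.integral_finsetSum fun j _ =>
      net.intervalIntegrable (fun k => (Q * lap (net.graph k) * Qᵀ) i j * y j) _ _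
  rw [h3, Finset.mul_sum]
  simp only [act, Matrix.mulVec, dotProduct]
  refine Finset.sum_congr rfl fun j _ => ?_
  rw [intervalIntegral.integral_mul_const, avgLap, Matrix.of_apply, mul_assoc]
  congr 2
  refine intervalIntegral.integral_congr fun s hs => ?_
  rw [uIcc_of_le (by linarith)] at hs
  simp only [max_eq_left (ht.trans hs.1)]

theorem le_inner_avg_of_isPEConnected {net : SwitchingNetwork N}
    {Q : Matrix (Fin (N - 1)) (Fin N) ℝ} {μ T t : ℝ} (hPE : IsPEConnected net Q μ T)
    (hT : 0 ≤ T) (ht : 0 ≤ t) (y : EuclideanSpace ℝ (Fin (N - 1))) :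
    μ * ‖y‖ ^ 2 ≤ inner ℝ y ((T⁻¹ • ∫ s in t..(t + T), reducedLap net Q s) y) := by
  rw [← act_avgLap net Q hT ht, inner_eq_dotProduct, ← real_inner_self_eq_norm_sq,
    inner_eq_dotProduct]
  have h := (hPE t ht).dotProduct_mulVec_nonneg (WithLp.ofLp y)
  rw [Matrix.sub_mulVec, Matrix.smul_mulVec, Matrix.one_mulVec, dotProduct_sub, dotProduct_smul] at h
  simp only [star_trivial, smul_eq_mul] at h
  simp only [act]
  linarith

end Excitation

/-! ### Decay of the output along trajectories -/

theorem IsAdmissibleInput.integrableOn {E : Type*} [NormedAddCommGroup E] {p : ENNReal} {t₀ : ℝ}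
    {u : ℝ → E} (hu : IsAdmissibleInput p t₀ u) (hp : 1 ≤ p) (t : ℝ) :
    IntegrableOn u (Icc t₀ t) := by
  rcases lt_or_ge t t₀ with h | h
  · simp [Icc_eq_empty_of_lt h]
  · exact (hu.memLpe t h).integrable hp

theorem IsTrajectory.exists_lipschitzOnWith {N : ℕ} {net : SwitchingNetwork N} {α γ : ℝ}
    {adv : Finset (Fin N)} {p : ENNReal} {u : ℝ → EuclideanSpace ℝ adv} {t₀ : ℝ}
    {x : ℝ → EuclideanSpace ℝ (Fin N ⊕ Fin N)} (hx : IsTrajectory net α γ adv u t₀ x)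
    (hu : IsAdmissibleInput p t₀ u) {b : ℝ} (hb : t₀ ≤ b) :
    ∃ C : NNReal, LipschitzOnWith C x (Icc t₀ b) := by
  obtain ⟨K, hK⟩ := Finite.bddAbove_range fun G : SimpleGraph (Fin N) => ‖actL (sysMatrix G α γ)‖
  obtain ⟨X, hX⟩ := isCompact_Icc.exists_bound_of_continuousOn
    (hx.continuousOn.mono fun s (hs : s ∈ Icc t₀ b) => hs.1)
  obtain ⟨U, hU⟩ := hu.bounded b hb
  have hX0 : 0 ≤ X := (norm_nonneg _).trans (hX t₀ (left_mem_Icc.2 hb))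
  have hK0 : 0 ≤ K := (norm_nonneg _).trans (hK ⟨⊥, rfl⟩)
  refine ⟨(K * X + ‖actL (inputMatrix adv)‖ * U).toNNReal, lipschitzOnWith_of_eq_integral
    (f := fun s => act (sysMatrix (net.graphAt s) α γ) (x s) + act (inputMatrix adv) (u s))
    (fun t ht => ?_) (fun t ht => hx.integrable t ht.1) (fun t ht => hx.integral_eq t ht.1)⟩
  refine le_trans ?_ (Real.le_coe_toNNReal _)
  refine (norm_add_le _ _).trans (add_le_add ?_ ?_)
  · refine ((actL (sysMatrix (net.graphAt t) α γ)).le_of_opNorm_le (hK ⟨_, rfl⟩) (x t)).trans ?_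
    gcongr
    exact hX t ht
  · refine ((actL (inputMatrix adv)).le_opNorm (u t)).trans ?_
    gcongr
    exact hU ⟨t, ht, rfl⟩

/-- The estimate of `norm_le_of_persistent_excitation` for `col(χ, v) = C⁻¹ 𝒴`, with `ε = α / γ`,
read in terms of the output. -/
theorem norm_output_le_of_isTrajectory {N : ℕ} {μ T α γ lam K : ℝ} (hμ : 0 < μ) (hT : 0 < T)
    (hα : 0 < α) (hγ : 0 < γ) (hK : 0 < K)
    (hlap : ∀ G : SimpleGraph (Fin N), ‖actL (lap G)‖ ≤ K)
    (h1 : α / γ * K * T ≤ 1 / 6) (h2 : 12 * (α / γ * K * T) * K ≤ μ)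
    (h3 : α / γ * (2 * K + 19 * (K ^ 2 / μ) + μ) ≤ 2 * γ) (hlam : 0 ≤ lam)
    (hlam' : lam ≤ α / γ * μ / 2) {Q : Matrix (Fin (N - 1)) (Fin N) ℝ}
    (hQ : IsDisagreementMatrix Q) {net : SwitchingNetwork N} (hPE : IsPEConnected net Q μ T)
    {t₀ : ℝ} (ht₀ : 0 ≤ t₀) {adv : Finset (Fin N)} {p : ENNReal} (hp : 1 ≤ p)
    {u : ℝ → EuclideanSpace ℝ adv} {x : ℝ → EuclideanSpace ℝ (Fin N ⊕ Fin N)}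
    (hu : IsAdmissibleInput p t₀ u) (hx : IsTrajectory net α γ adv u t₀ x) {t : ℝ} (ht : t₀ ≤ t) :
    ‖output Q (x t)‖ ≤
      opNorm (Cmat Q γ) * √2 * opNorm (Cmat Q γ)⁻¹ * Real.exp (-lam * (t - t₀)) * ‖x t₀‖ +
        opNorm (Cmat Q γ) * 4 * expConv lam t₀ u t := by
  have hε : 0 < α / γ := div_pos hα hγ
  have hQn : ∀ y, ‖act Q y‖ ≤ 1 * ‖y‖ := fun y => by
    rw [one_mul]; exact norm_act_le_norm hQ.mul_transpose y
  have hQt : ‖actL Qᵀ‖ ≤ 1 := ContinuousLinearMap.opNorm_le_bound _ zero_le_one fun y => by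
    rw [actL_apply, norm_act_eq (by simpa using hQ.mul_transpose), one_mul]
  have hLn : ∀ (G : SimpleGraph (Fin N)) (y), ‖act (lap G) y‖ ≤ K * ‖y‖ := fun G y =>
    (actL (lap G)).le_of_opNorm_le (hlap G) y
  have hB : ∀ G : SimpleGraph (Fin N), ‖actL (Q * lap G : Matrix (Fin (N - 1)) (Fin N) ℝ)‖ ≤ K :=
    fun G => by
    simpa using norm_actL_mul_le hQn zero_le_one (hlap G)
  have hB' : ∀ G : SimpleGraph (Fin N), ‖actL (lap G * Qᵀ : Matrix (Fin N) (Fin (N - 1)) ℝ)‖ ≤ K :=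
    fun G => by
    simpa using norm_actL_mul_le (hLn G) hK.le hQt
  have hM : ∀ G : SimpleGraph (Fin N), ‖actL (Q * lap G * Qᵀ : Matrix (Fin (N - 1)) (Fin (N - 1)) ℝ)‖ ≤ K :=
    fun G => by
    rw [Matrix.mul_assoc]
    simpa using norm_actL_mul_le hQn zero_le_one (hB' G)
  have hMloc := locallyIntegrable_reducedLap net Q
  have hMint : ∀ a b, IntervalIntegrable (reducedLap net Q) volume a b := fun a b =>
    intervalIntegrable_reducedLap net Q a b
  have hMn : ∀ s, ‖reducedLap net Q s‖ ≤ K := fun s => hM _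
  have hωi : IntervalIntegrable (fun s => ‖u s‖) volume t₀ t :=
    (intervalIntegrable_iff_integrableOn_Icc_of_le ht).2 (hu.integrableOn hp t).norm
  obtain ⟨C, hC⟩ := hx.exists_lipschitzOnWith hu ht
  have hder := ae_hasDerivAt_of_eq_integral (hx.integrable t ht) fun s hs => hx.integral_eq s hs.1
  have key := norm_le_of_persistent_excitation (ε := α / γ) (γ := γ) (a := t₀) (b := t)
    (R := corrector (reducedLap net Q) T) (M := reducedLap net Q)
    (Mavg := fun s => T⁻¹ • ∫ r in s..(s + T), reducedLap net Q r)
    (B := fun s => actL (Q * lap (net.graphAt s) : Matrix (Fin (N - 1)) (Fin N) ℝ))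
    (B' := fun s => actL (lap (net.graphAt s) * Qᵀ : Matrix (Fin N) (Fin (N - 1)) ℝ))
    (L := fun s => actL (lap (net.graphAt s)))
    (χ := fun s => actL (chiMat Q γ) (x s)) (v := fun s => actL (velMat N) (x s))
    (q := fun s => act (Q * attackDir adv : Matrix (Fin (N - 1)) adv ℝ) (u s))
    (r := fun s => act (attackDir adv) (u s))
    (ω := fun s => ‖u s‖) hε hμ hK hT h1 h2 h3 ht hlam hlam'
    ((lipschitzWith_corrector hT hMint hMn).lipschitzOnWith)
    ((actL (chiMat Q γ)).lipschitz.comp_lipschitzOnWith hC)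
    ((actL (velMat N)).lipschitz.comp_lipschitzOnWith hC)
    (fun s _ => norm_corrector_le hT hMint hMn s) (fun s _ => hMn s) (fun s _ => hB _)
    (fun s _ => hB' _) (fun s _ => hlap _)
    (fun s hs y => le_inner_avg_of_isPEConnected hPE hT.le (ht₀.trans hs.1) y)
    (fun s => by
      rw [act_mul]
      exact (norm_act_le_norm hQ.mul_transpose _).trans
        (norm_act_eq (attackDir_transpose_mul adv) _).le)
    (fun s => (norm_act_eq (attackDir_transpose_mul adv) _).le) hωi
    ((ae_hasDerivAt_corrector T hMint hMloc).mono fun s hs _ => hs)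
    (hder.mono fun s hs hsI => by
      refine ((actL (chiMat Q γ)).hasFDerivAt.comp_hasDerivAt s (hs hsI)).congr_deriv ?_
      have h0 : max s 0 = s := max_eq_left (ht₀.trans hsI.1.le)
      simp only [actL_apply, reducedLap, h0]
      rw [act_add, ← act_mul, ← act_mul, chiMat_mul_inputMatrix,
        chiMat_mul_sysMatrix hQ _ hγ.ne', act_add_matrix, act_neg_matrix, act_smul_matrix,
        act_smul_matrix, act_mul _ (chiMat Q γ), act_mul _ (velMat N)])
    (hder.mono fun s hs hsI => by
      refine ((actL (velMat N)).hasFDerivAt.comp_hasDerivAt s (hs hsI)).congr_deriv ?_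
      simp only [actL_apply]
      rw [act_add, ← act_mul, ← act_mul, velMat_mul_inputMatrix,
        velMat_mul_sysMatrix hQ _ hγ.ne', act_add_matrix, act_add_matrix, act_neg_matrix,
        act_neg_matrix, act_smul_matrix, act_smul_matrix, act_smul_matrix,
        act_mul _ (chiMat Q γ), act_mul (lap _) (velMat N), sub_eq_add_neg])
  simp only [actL_apply, ← norm_stack] at key
  have hC0 := opNorm_nonneg (Cmat Q γ)
  calc ‖output Q (x t)‖
      ≤ opNorm (Cmat Q γ) * ‖stack (act (chiMat Q γ) (x t)) (act (velMat N) (x t))‖ := by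
        rw [output_eq hγ.ne']; exact norm_act_le_opNorm _ _
    _ ≤ opNorm (Cmat Q γ) * (√2 * Real.exp (-lam * (t - t₀)) *
          (opNorm (Cmat Q γ)⁻¹ * ‖x t₀‖) + 4 * expConv lam t₀ u t) := by
        refine mul_le_mul_of_nonneg_left (key.trans ?_) hC0
        unfold expConv
        gcongr
        rw [stack_coordinates hγ.ne']
        refine (norm_act_le_opNorm _ _).trans ?_
        have := opNorm_nonneg (Cmat Q γ)⁻¹
        gcongr
        exact norm_output_le hQ _
    _ = _ := by ring

/-! ### The constants -/

/-- `μ ≤ N` keeps the argument of the logarithm in `η` positive. The upper bound is half of the rate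
`(α / γ) μ` of the averaged dynamics, and this slack is what leaves room for the coupling. -/
theorem lamChi_bounds {N : ℕ} {μ T α γ : ℝ} (hN : 3 ≤ N) (hμ : 0 < μ) (hμN : μ ≤ N) (hT : 0 < T)
    (hα : 0 < α) (hγ : 0 < γ) :
    0 < lamChi N μ T α γ ∧ lamChi N μ T α γ ≤ α / γ * μ / 2 := by
  have hε : 0 < α / γ := div_pos hα hγ
  have hN0 : (0 : ℝ) < N := by positivity
  set ε := α / γ with hεd
  set y := ε * μ * T / (1 + ε ^ 2 * (N : ℝ) ^ 2 * T ^ 2) with hy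
  have hden : 0 < 1 + ε ^ 2 * (N : ℝ) ^ 2 * T ^ 2 := by positivity
  have hy0 : 0 < y := by positivity
  have hyle : y ≤ ε * μ * T := div_le_self (by positivity) (by
    linarith [show 0 ≤ ε ^ 2 * (N : ℝ) ^ 2 * T ^ 2 by positivity])
  have hy1 : y < 1 := by
    rw [hy, div_lt_one hden]
    have : ε * μ * T ≤ ε * N * T := by gcongr
    nlinarith [sq_nonneg (ε * N * T - 1), show 0 < ε * N * T by positivity]
  have hlog : Real.log (1 - y) < 0 := Real.log_neg (by linarith) (by linarith)
  have heta : eta N μ T α γ = -(1 / (2 * T)) * Real.log (1 - y) := rfl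
  have hexp : Real.exp (-2 * eta N μ T α γ * T) = 1 - y := by
    rw [heta, show -2 * (-(1 / (2 * T)) * Real.log (1 - y)) * T = Real.log (1 - y) by field_simp,
      Real.exp_log (by linarith)]
  have hpos : 0 < eta N μ T α γ := by
    rw [heta]
    exact mul_pos_of_neg_of_neg (by simpa using by positivity) hlog
  unfold lamChi
  rw [hexp]
  refine ⟨mul_pos hpos (by linarith), ?_⟩
  -- `-(1 - y) log (1 - y) ≤ y`
  have h1 : -Real.log (1 - y) * (1 - y) ≤ y := by
    have h := Real.log_le_sub_one_of_pos (inv_pos.2 (show 0 < 1 - y by linarith))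
    rw [Real.log_inv] at h
    have h' := mul_le_mul_of_nonneg_right h (show 0 ≤ 1 - y by linarith)
    rw [sub_mul, inv_mul_cancel₀ (by linarith)] at h'
    linarith
  rw [heta]
  have : -(1 / (2 * T)) * Real.log (1 - y) * (1 - y) = (-Real.log (1 - y) * (1 - y)) / (2 * T) := by
    field_simp
  rw [this, div_le_iff₀ (by positivity)]
  linarith

/-- The ratio in `κ_x` and `κ_u` is at least `λ_χ⁻¹ / (γ / (α N))`, its value for `β` between
`γ / (α N)` and `λ_χ⁻¹`, and this is at least `2 N / μ`. -/
theorem two_le_ratio {N : ℕ} {μ α γ lam β : ℝ} (hN : 3 ≤ N) (hμN : μ ≤ N)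
    (hα : 0 < α) (hγ : 0 < γ) (hlam : 0 < lam) (hlam' : lam ≤ α / γ * μ / 2) (hβ : 0 < β) :
    2 ≤ max lam⁻¹ β / min (γ / (α * N)) β := by
  have hN0 : (0 : ℝ) < N := by positivity
  have hb : 0 < γ / (α * N) := by positivity
  rw [le_div_iff₀ (lt_min hb hβ)]
  have h1 : 2 * (γ / (α * N)) ≤ lam⁻¹ := by
    rw [le_inv_comm₀ (by positivity) hlam]
    refine hlam'.trans ?_
    rw [show (2 * (γ / (α * N)))⁻¹ = α / γ * N / 2 by field_simp]
    gcongr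
  calc 2 * min (γ / (α * N)) β ≤ 2 * (γ / (α * N)) := by gcongr; exact min_le_left _ _
    _ ≤ max lam⁻¹ β := h1.trans (le_max_left _ _)

theorem le_kappaX {N : ℕ} {Q : Matrix (Fin (N - 1)) (Fin N) ℝ} {μ T α γ β : ℝ}
    (h : 2 ≤ max (lamChi N μ T α γ)⁻¹ β / min (γ / (α * N)) β) :
    opNorm (Cmat Q γ) * √2 * opNorm (Cmat Q γ)⁻¹ ≤ kappaX Q μ T α γ β := by
  have h1 := opNorm_nonneg (Cmat Q γ)
  have h2 := opNorm_nonneg (Cmat Q γ)⁻¹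
  unfold kappaX
  gcongr

theorem le_kappaU {N : ℕ} {Q : Matrix (Fin (N - 1)) (Fin N) ℝ} {μ T α γ β lamX : ℝ}
    (hlamX : 0 < lamX) (h : 2 ≤ max (lamChi N μ T α γ)⁻¹ β / min (γ / (α * N)) β) :
    opNorm (Cmat Q γ) * 4 ≤ kappaU Q μ T α γ β lamX * lamX := by
  have h1 := opNorm_nonneg (Cmat Q γ)
  have hmin : min (γ / (2 * α * N)) (β / 2) = min (γ / (α * N)) β / 2 := by
    rw [← min_div_div_right (by norm_num : (0 : ℝ) ≤ 2)]
    congr 1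
    rw [div_div]; congr 1; ring
  unfold kappaU
  rw [hmin, mul_assoc]
  gcongr
  have : max (lamChi N μ T α γ)⁻¹ β / (lamX * (min (γ / (α * N)) β / 2)) * lamX =
      2 * (max (lamChi N μ T α γ)⁻¹ β / min (γ / (α * N)) β) := by
    field_simp
  rw [this]; linarith

/-! ### From the decay estimate to the stability claims -/

/-- All size conditions on the gain have the form `const ≤ γ`, with constants that depend only on
`N`, `μ`, `T`, `α`; the threshold `γ₀` is one plus the sum of these constants. -/
theorem exists_gain_threshold {N : ℕ} (hN : 3 ≤ N) {μ T α : ℝ} (hμ : 0 < μ) (hμN : μ ≤ N)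
    (hT : 0 < T) (hα : 0 < α) :
    ∃ γ₀ : ℝ, 0 < γ₀ ∧ ∀ γ : ℝ, γ₀ ≤ γ →
      0 < lamChi N μ T α γ ∧ lamChi N μ T α γ ≤ 1 ∧
      ∀ β : ℝ, 0 < β → ∀ lamX : ℝ, 0 < lamX → lamX < lamChi N μ T α γ →
      ∀ Q : Matrix (Fin (N - 1)) (Fin N) ℝ, IsDisagreementMatrix Q →
      0 ≤ kappaX Q μ T α γ β ∧ 0 ≤ kappaU Q μ T α γ β lamX ∧
      ∀ net : SwitchingNetwork N, IsPEConnected net Q μ T → ∀ t₀ : ℝ, 0 ≤ t₀ →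
      ∀ (adv : Finset (Fin N)) (p : ENNReal), 1 ≤ p →
      ∀ (u : ℝ → EuclideanSpace ℝ adv) (x : ℝ → EuclideanSpace ℝ (Fin N ⊕ Fin N)),
        IsAdmissibleInput p t₀ u → IsTrajectory net α γ adv u t₀ x → ∀ t : ℝ, t₀ ≤ t →
        ‖output Q (x t)‖ ≤ kappaX Q μ T α γ β * Real.exp (-lamX * (t - t₀)) * ‖x t₀‖ +
          kappaU Q μ T α γ β lamX * (lamX * expConv lamX t₀ u t) := by
  obtain ⟨K, hK, hlap⟩ := exists_lap_bound N
  have q1 : 0 ≤ α * K * T := by positivity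
  have q2 : 0 ≤ α * K ^ 2 * T / μ := by positivity
  have q3 : 0 ≤ α * K := by positivity
  have q4 : 0 ≤ α * (K ^ 2 / μ) := by positivity
  have q5 : 0 ≤ α * μ := by positivity
  refine ⟨1 + 6 * (α * K * T) + 12 * (α * K ^ 2 * T / μ) + 2 * (α * K) + 19 * (α * (K ^ 2 / μ)) +
    α * μ, by positivity, fun γ hγ₀ => ?_⟩
  have hγ1 : 1 ≤ γ := by linarith
  have hγ : 0 < γ := by linarith
  obtain ⟨hpos, hle⟩ := lamChi_bounds hN hμ hμN hT hα hγ
  refine ⟨hpos, hle.trans ?_, fun β hβ lamX hlamX hlamX' Q hQ => ?_⟩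
  · rw [div_mul_eq_mul_div, div_div, div_le_one (by positivity)]
    linarith
  have hratio := two_le_ratio hN hμN hα hγ hpos hle hβ
  have hX := le_kappaX (Q := Q) hratio
  have hU := le_kappaU (Q := Q) hlamX hratio
  have hC := opNorm_nonneg (Cmat Q γ)
  have hC' := opNorm_nonneg (Cmat Q γ)⁻¹
  refine ⟨le_trans (by positivity) hX,
    nonneg_of_mul_nonneg_left (le_trans (by positivity) hU) hlamX,
    fun net hPE t₀ ht₀ adv p hp u x hu hx t ht => ?_⟩
  have h1 : α / γ * K * T ≤ 1 / 6 := by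
    rw [div_mul_eq_mul_div, div_mul_eq_mul_div, div_le_iff₀ hγ]
    linarith
  have h2 : 12 * (α / γ * K * T) * K ≤ μ := by
    have e : 12 * (α / γ * K * T) * K = 12 * (α * K ^ 2 * T / μ) / γ * μ := by field_simp
    rw [e]
    refine mul_le_of_le_one_left hμ.le ((div_le_one hγ).2 ?_)
    linarith
  have h3 : α / γ * (2 * K + 19 * (K ^ 2 / μ) + μ) ≤ 2 * γ := by
    have e : α / γ ≤ α := div_le_self hα.le hγ1
    have e' : α / γ * (2 * K + 19 * (K ^ 2 / μ) + μ) ≤ α * (2 * K + 19 * (K ^ 2 / μ) + μ) := by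
      gcongr
    linarith
  refine (norm_output_le_of_isTrajectory hμ hT hα hγ hK hlap h1 h2 h3 hlamX.le
    (hlamX'.le.trans hle) hQ hPE ht₀ hp hu hx ht).trans ?_
  rw [← mul_assoc (kappaU Q μ T α γ β lamX)]
  have hconv : 0 ≤ expConv lamX t₀ u t :=
    intervalIntegral.integral_nonneg ht fun s _ => by positivity
  gcongr

section Signals

variable {E F : Type*} [NormedAddCommGroup E] [NormedAddCommGroup F] {p : ENNReal}
  {t₀ lam κ c : ℝ} {u : ℝ → E} {y : ℝ → F}

theorem truncNorm_le_of_norm_le (hlam : 0 < lam) (hκ : 0 ≤ κ) (hp : 1 ≤ p)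
    (hu : IsAdmissibleInput p t₀ u) {f : ℝ → ℝ} (hf : Continuous f)
    (hy : ∀ t, t₀ ≤ t → ‖y t‖ ≤ f t + κ * (lam * expConv lam t₀ u t)) (Td : ℝ) :
    truncNorm p t₀ Td y ≤ truncNorm p t₀ Td f + ENNReal.ofReal κ * truncNorm p t₀ Td u := by
  have huI := hu.integrableOn hp Td
  have hmeas : AEStronglyMeasurable (fun t => lam * expConv lam t₀ u t)
      (volume.restrict (Icc t₀ Td)) :=
    ((continuousOn_expConv (lam := lam) huI).aestronglyMeasurable measurableSet_Icc).const_mul lam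
  calc truncNorm p t₀ Td y
      ≤ eLpNorm (f + κ • fun t => lam * expConv lam t₀ u t) p (volume.restrict (Icc t₀ Td)) := by
        refine eLpNorm_mono_ae ?_
        refine (ae_restrict_iff' measurableSet_Icc).2 (Eventually.of_forall fun t ht => ?_)
        exact (hy t ht.1).trans (le_abs_self _)
    _ ≤ eLpNorm f p (volume.restrict (Icc t₀ Td)) +
          eLpNorm (κ • fun t => lam * expConv lam t₀ u t) p (volume.restrict (Icc t₀ Td)) :=
        eLpNorm_add_le hf.aestronglyMeasurable (hmeas.const_smul κ) hp
    _ ≤ _ := by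
        refine add_le_add le_rfl ?_
        rw [eLpNorm_const_smul, ← ofReal_norm, Real.norm_of_nonneg hκ]
        exact mul_le_mul_right (eLpNorm_expConv_le hlam huI hp) _

theorem ofReal_norm_le_of_norm_le (hlam : 0 < lam) (hlam1 : lam ≤ 1) (hκ : 0 ≤ κ) (hp : 1 ≤ p)
    (hu : IsAdmissibleInput p t₀ u) {t : ℝ} (ht : t₀ ≤ t) {y₀ : F} (hc : 0 ≤ c)
    (hy : ‖y₀‖ ≤ c + κ * (lam * expConv lam t₀ u t)) :
    ENNReal.ofReal ‖y₀‖ ≤ ENNReal.ofReal c + ENNReal.ofReal κ * truncNorm p t₀ t u := by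
  have hconv : 0 ≤ expConv lam t₀ u t :=
    intervalIntegral.integral_nonneg ht fun s _ => by positivity
  refine (ENNReal.ofReal_le_ofReal hy).trans ?_
  rw [ENNReal.ofReal_add hc (by positivity), ENNReal.ofReal_mul hκ]
  exact add_le_add le_rfl (mul_le_mul_right
    (ofReal_expConv_le_eLpNorm hlam hlam1 (hu.integrableOn hp t) ht hp) _)

theorem exists_truncNorm_exp_le (hlam : 0 < lam) (hp : 1 ≤ p) (t₀ : ℝ) (hc : 0 ≤ c) :
    ∃ b : ℝ, 0 ≤ b ∧ ∀ Td,
      truncNorm p t₀ Td (fun t => c * Real.exp (-lam * (t - t₀))) ≤ ENNReal.ofReal b := by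
  obtain ⟨B, hB⟩ := exists_eLpNorm_exp_le hlam t₀ hp
  refine ⟨c * B, by positivity, fun Td => ?_⟩
  have h : (fun t => c * Real.exp (-lam * (t - t₀))) = c • fun t => Real.exp (-lam * (t - t₀)) := rfl
  rw [truncNorm, h, eLpNorm_const_smul, ← ofReal_norm, Real.norm_of_nonneg hc,
    ENNReal.ofReal_mul hc, ENNReal.ofReal_coe_nnreal]
  exact mul_le_mul_right (hB Td) _

theorem isAdmissibleInput_zero (p : ENNReal) (t₀ : ℝ) :
    IsAdmissibleInput p t₀ (fun _ : ℝ => (0 : E)) where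
  memLpe _ _ := MemLp.zero'
  bounded _ _ := ⟨0, by rintro _ ⟨t, -, rfl⟩; simp⟩

end Signals

/-- `Qᵀ Q` removes the mean, which differences of coordinates do not see. -/
theorem abs_sub_le_of_isDisagreementMatrix {N : ℕ} {Q : Matrix (Fin (N - 1)) (Fin N) ℝ}
    (hQ : IsDisagreementMatrix Q) (y : EuclideanSpace ℝ (Fin N)) (i j : Fin N) :
    |y i - y j| ≤ √2 * ‖act Q y‖ := by
  rcases eq_or_ne i j with rfl | hij
  · simp only [sub_self, abs_zero]; positivity
  set w := act Qᵀ (act Q y) with hw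
  have hwn : ‖w‖ = ‖act Q y‖ := norm_act_eq (by simpa using hQ.mul_transpose) _
  have hwk : ∀ k, w k = y k - (N : ℝ)⁻¹ * ∑ l, y l := by
    intro k
    rw [hw, ← act_mul, hQ.transpose_mul]
    simp [act, Matrix.sub_mulVec, Matrix.mulVec, dotProduct, Finset.mul_sum]
  have hsum : w i ^ 2 + w j ^ 2 ≤ ‖w‖ ^ 2 := by
    rw [EuclideanSpace.norm_sq_eq, ← Finset.sum_pair (f := fun k => w k ^ 2) hij]
    simp only [Real.norm_eq_abs, sq_abs]
    exact Finset.sum_le_sum_of_subset_of_nonneg (Finset.subset_univ _) fun k _ _ => sq_nonneg _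
  have he : y i - y j = w i - w j := by rw [hwk, hwk]; ring
  rw [he, ← hwn]
  refine abs_le_of_sq_le_sq ?_ (by positivity)
  rw [mul_pow, Real.sq_sqrt zero_le_two]
  linear_combination 2 * hsum + sq_nonneg (w i + w j)

theorem norm_act_le_norm_output_stack {N : ℕ} (Q : Matrix (Fin (N - 1)) (Fin N) ℝ)
    (p v : EuclideanSpace ℝ (Fin N)) :
    ‖act Q p‖ ≤ ‖output Q (stack p v)‖ ∧ ‖v‖ ≤ ‖output Q (stack p v)‖ := by
  rw [output_stack, norm_stack]
  exact ⟨Real.le_sqrt_of_sq_le (by linarith [sq_nonneg ‖v‖]),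
    Real.le_sqrt_of_sq_le (by linarith [sq_nonneg ‖act Q p‖])⟩

theorem tendsto_exp_neg_mul_sub {lam : ℝ} (hlam : 0 < lam) (t₀ : ℝ) :
    Tendsto (fun t => Real.exp (-lam * (t - t₀))) atTop (𝓝 0) := by
  refine Real.tendsto_exp_atBot.comp ?_
  exact (tendsto_atTop_add_const_right _ (-t₀) tendsto_id).const_mul_atTop_of_neg (by linarith)

end PEConsensus

end

theorem proposition2 (N : ℕ) (hN : 3 ≤ N) (μ T α : ℝ) (hμ : 0 < μ) (hμN : μ ≤ N) (hT : 0 < T)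
    (hα : 0 < α) :
    ∃ γ₀ : ℝ, 0 < γ₀ ∧ ∀ γ : ℝ, γ₀ ≤ γ →
      0 < PEConsensus.lamChi N μ T α γ ∧
      ∀ β : ℝ, 0 < β → ∀ lamX : ℝ, 0 < lamX → lamX < PEConsensus.lamChi N μ T α γ →
      ∀ Q : Matrix (Fin (N - 1)) (Fin N) ℝ, PEConsensus.IsDisagreementMatrix Q →
      ∀ net : PEConsensus.SwitchingNetwork N, PEConsensus.IsPEConnected net Q μ T →
      ∀ D : PEConsensus.DoSAttack net, D.TotalLessThan T →
      ∀ t₀ : ℝ, 0 ≤ t₀ →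
        -- finite-gain stability with the explicit bounds, for every attack
        (∀ adv : Finset (Fin N), ∀ p : ENNReal, 1 ≤ p →
          (∀ x₀ : EuclideanSpace ℝ (Fin N ⊕ Fin N),
            PEConsensus.IsFiniteGainLpStable p t₀ (PEConsensus.ioPairs net Q α γ adv p t₀ x₀)
              (PEConsensus.kappaU Q μ T α γ β lamX)) ∧
          ∀ (u : ℝ → EuclideanSpace ℝ adv) (x : ℝ → EuclideanSpace ℝ (Fin N ⊕ Fin N)),
            PEConsensus.IsAdmissibleInput p t₀ u →
            PEConsensus.IsTrajectory net α γ adv u t₀ x →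
            (∀ Td : ℝ, t₀ ≤ Td →
              PEConsensus.truncNorm p t₀ Td (fun t => PEConsensus.output Q (x t)) ≤
                PEConsensus.truncNorm p t₀ Td (fun t =>
                  PEConsensus.kappaX Q μ T α γ β * Real.exp (-lamX * (t - t₀)) * ‖x t₀‖) +
                ENNReal.ofReal (PEConsensus.kappaU Q μ T α γ β lamX) *
                  PEConsensus.truncNorm p t₀ Td u) ∧
            (∀ t : ℝ, t₀ ≤ t →
              ENNReal.ofReal ‖PEConsensus.output Q (x t)‖ ≤
                ENNReal.ofReal
                  (PEConsensus.kappaX Q μ T α γ β * Real.exp (-lamX * (t - t₀)) * ‖x t₀‖) +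
                ENNReal.ofReal (PEConsensus.kappaU Q μ T α γ β lamX) *
                  PEConsensus.truncNorm p t₀ t u)) ∧
        -- exponential convergence without attack input
        (∀ (adv : Finset (Fin N)) (pstar : EuclideanSpace ℝ (Fin N))
            (p v : ℝ → EuclideanSpace ℝ (Fin N)),
          PEConsensus.IsTrajectory net α γ adv (fun _ => 0) t₀
            (fun t => PEConsensus.stack (p t - pstar) (v t)) →
          (∀ t : ℝ, t₀ ≤ t →
            (∀ i j : Fin N, |p t i - p t j - (pstar i - pstar j)| ≤
              Real.sqrt 2 * PEConsensus.kappaX Q μ T α γ β * Real.exp (-lamX * (t - t₀)) *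
                ‖PEConsensus.stack (p t₀ - pstar) (v t₀)‖) ∧
            (∀ i : Fin N, |v t i| ≤
              PEConsensus.kappaX Q μ T α γ β * Real.exp (-lamX * (t - t₀)) *
                ‖PEConsensus.stack (p t₀ - pstar) (v t₀)‖)) ∧
          (∀ i j : Fin N,
            Tendsto (fun t => |p t i - p t j - (pstar i - pstar j)|) atTop (𝓝 0)) ∧
          (∀ i : Fin N, Tendsto (fun t => |v t i|) atTop (𝓝 0))) := by
  obtain ⟨γ₀, hγ₀, H⟩ := PEConsensus.exists_gain_threshold hN hμ hμN hT hα
  refine ⟨γ₀, hγ₀, fun γ hγ => ?_⟩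
  obtain ⟨hpos, hle1, H⟩ := H γ hγ
  refine ⟨hpos, fun β hβ lamX hlamX hlamX' Q hQ net hPE D _ t₀ ht₀ => ?_⟩
  obtain ⟨hX, hU, H⟩ := H β hβ lamX hlamX hlamX' Q hQ
  replace H := H net hPE t₀ ht₀
  set κX := PEConsensus.kappaX Q μ T α γ β
  set κU := PEConsensus.kappaU Q μ T α γ β lamX
  refine ⟨fun adv p hp => ?_, fun adv pstar p v hx => ?_⟩
  · have hLp : ∀ (u : ℝ → EuclideanSpace ℝ adv) (x : ℝ → EuclideanSpace ℝ (Fin N ⊕ Fin N)),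
        PEConsensus.IsAdmissibleInput p t₀ u → PEConsensus.IsTrajectory net α γ adv u t₀ x →
        ∀ Td : ℝ, PEConsensus.truncNorm p t₀ Td (fun t => PEConsensus.output Q (x t)) ≤
          PEConsensus.truncNorm p t₀ Td (fun t => κX * Real.exp (-lamX * (t - t₀)) * ‖x t₀‖) +
            ENNReal.ofReal κU * PEConsensus.truncNorm p t₀ Td u := fun u x hu hx Td =>
      PEConsensus.truncNorm_le_of_norm_le hlamX hU hp hu (by fun_prop) (H adv p hp u x hu hx) Td
    refine ⟨fun x₀ => ⟨hU, ?_⟩, fun u x hu hx => ⟨fun Td _ => hLp u x hu hx Td, fun t ht => ?_⟩⟩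
    · obtain ⟨b, hb, hbias⟩ := PEConsensus.exists_truncNorm_exp_le (c := κX * ‖x₀‖) hlamX hp t₀
        (by positivity)
      refine ⟨b, hb, ?_⟩
      rintro ⟨u, y⟩ ⟨hu, x, hx, hx₀, hy⟩ Td _
      simp only at hu hx hy ⊢
      subst hy
      refine (hLp u x hu hx Td).trans ?_
      rw [add_comm, hx₀]
      refine add_le_add le_rfl (le_trans (le_of_eq ?_) (hbias Td))
      congr 1; ext t; ring
    · exact PEConsensus.ofReal_norm_le_of_norm_le hlamX (hlamX'.le.trans hle1) hU hp hu ht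
        (by positivity) (H adv p hp u x hu hx t ht)
  · have hout : ∀ t, t₀ ≤ t → ‖PEConsensus.output Q (PEConsensus.stack (p t - pstar) (v t))‖ ≤
        κX * Real.exp (-lamX * (t - t₀)) * ‖PEConsensus.stack (p t₀ - pstar) (v t₀)‖ := by
      intro t ht
      refine (H adv 1 le_rfl _ _ (PEConsensus.isAdmissibleInput_zero 1 t₀) hx t ht).trans_eq ?_
      simp [PEConsensus.expConv]
    have hpos' : ∀ t, t₀ ≤ t → ∀ i j : Fin N, |p t i - p t j - (pstar i - pstar j)| ≤
        √2 * κX * Real.exp (-lamX * (t - t₀)) * ‖PEConsensus.stack (p t₀ - pstar) (v t₀)‖ := by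
      intro t ht i j
      have h1 := PEConsensus.abs_sub_le_of_isDisagreementMatrix hQ (p t - pstar) i j
      have h2 :=
        (PEConsensus.norm_act_le_norm_output_stack Q (p t - pstar) (v t)).1.trans (hout t ht)
      have h3 := mul_le_mul_of_nonneg_left h2 (Real.sqrt_nonneg 2)
      rw [PiLp.sub_apply, PiLp.sub_apply, sub_sub_sub_comm] at h1
      linarith
    have hvel : ∀ t, t₀ ≤ t → ∀ i : Fin N, |v t i| ≤
        κX * Real.exp (-lamX * (t - t₀)) * ‖PEConsensus.stack (p t₀ - pstar) (v t₀)‖ :=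
      fun t ht i => (PiLp.norm_apply_le (v t) i).trans
        ((PEConsensus.norm_act_le_norm_output_stack Q (p t - pstar) (v t)).2.trans (hout t ht))
    have hexp := PEConsensus.tendsto_exp_neg_mul_sub hlamX t₀
    refine ⟨fun t ht => ⟨hpos' t ht, hvel t ht⟩, fun i j => ?_, fun i => ?_⟩
    · refine squeeze_zero' (Eventually.of_forall fun t => abs_nonneg _)
        ((eventually_ge_atTop t₀).mono fun t ht => hpos' t ht i j) ?_
      simpa using (hexp.const_mul (√2 * κX)).mul_const
        ‖PEConsensus.stack (p t₀ - pstar) (v t₀)‖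
    · refine squeeze_zero' (Eventually.of_forall fun t => abs_nonneg _)
        ((eventually_ge_atTop t₀).mono fun t ht => hvel t ht i) ?_
      simpa using (hexp.const_mul κX).mul_const ‖PEConsensus.stack (p t₀ - pstar) (v t₀)‖
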